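/- Let $d\ge 3$ be an integer, $\gamma\in(0,2)$, $2^*_\gamma:=2\,\frac{d-\gamma}{d-2}$ and $1<p<2^*_\gamma/2$. For $q\geq 1$ put $\|w\|_{q,\gamma}:=\big(\int_{\mathbb R^d}|w|^q\,|x|^{-\gamma}\,dx\big)^{1/q}$ and $\|w\|_q:=\|w\|_{q,0}$. Let $L^q_\gamma(\mathbb R^d)$ be the space of (a.e. classes of) measurable functions $w:\mathbb R^d\to\mathbb R$ with $\|w\|_{q,\gamma}<\infty$, and let $\mathcal H_{p,\gamma}(\mathbb R^d)$ be the space of those $w\in L^{p+1}_\gamma(\mathbb R^d)$ whose distributional gradient $\nabla w$ belongs to $L^2(\mathbb R^d)$, with norm $\|w\|_{p+1,\gamma}+\|\nabla w\|_2$. For $w\in\mathcal H_{p,\gamma}(\mathbb R^d)$ let $$\mathcal G_\gamma[w]:=\tfrac12\,\|\nabla w\|_2^2+\tfrac1{p+1}\,\|w\|_{p+1,\gamma}^{p+1},\qquad \theta_\gamma:=\frac{d+2-2\gamma-p\,(d-2)}{d-\gamma-p\,(d+\gamma-4)},$$ and let $\mathsf J_\gamma$ be the largest constant such that $\mathcal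 G_\gamma[w]-\mathsf J_\gamma\,\|w\|_{2p,\gamma}^{2p\,\theta_\gamma}\ge0$ for all $w\in\mathcal H_{p,\gamma}(\mathbb R^d)$. Then: 1. $\mathcal H_{p,\gamma}(\mathbb R^d)$ is compactly embedded in $L^{2p}_\gamma(\mathbb R^d)$: every $w\in\mathcal H_{p,\gamma}(\mathbb R^d)$ belongs to $L^{2p}_\gamma(\mathbb R^d)$, and the inclusion is an injective, continuous and compact linear map. 2. For every $M>0$, $$\mathsf J_\gamma=\frac1{M^{\theta_\gamma}}\,\inf\big\{\mathcal G_\gamma[w]\,:\,w\in\mathcal H_{p,\gamma}(\mathbb R^d),\ \|w\|_{2p,\gamma}^{2p}=M\big\},$$ and the infimum is attained: there is $w_\gamma\in\mathcal H_{p,\gamma}(\mathbb R^d)$ with $\|w_\gamma\|_{2p,\gamma}^{2p}=M$ and $\mathcal G_\gamma[w_\gamma]=\mathsf J_\gamma\,M^{\theta_\gamma}$, so that $w_\gamma$ minimizes $\mathcal G_\gamma$ among all functions in $\mathcal H_{p,\gamma}(\mathbb R^d)$ with mass $M$. -/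

import Mathlib

open MeasureTheory
open scoped ENNReal ContDiff

noncomputable section

namespace CKN

/-- The Euclidean space `ℝ^d`. -/
abbrev Space (d : ℕ) : Type := EuclideanSpace ℝ (Fin d)

/-- The measure `|x|^{-γ} dx` on `ℝ^d`. -/
def weightedMeasure (d : ℕ) (γ : ℝ) : Measure (Space d) :=
  volume.withDensity fun x => ENNReal.ofReal (‖x‖ ^ (-γ))

/-- The weighted norm `‖f‖_{q,γ} = (∫ |f|^q |x|^{-γ} dx)^{1/q}`. -/
def wnorm {d : ℕ} {F : Type*} [NormedAddCommGroup F] (q γ : ℝ) (f : Space d → F) : ℝ :=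
  (∫ x, ‖f x‖ ^ q * ‖x‖ ^ (-γ)) ^ (1 / q)

/-- The critical exponent `2^*_γ = 2 (d - γ) / (d - 2)`. -/
def critExp (d : ℕ) (γ : ℝ) : ℝ := 2 * ((d - γ) / (d - 2))

/-- The space `L^q_γ(ℝ^d)` of (classes of) real functions with `‖f‖_{q,γ} < ∞`. -/
abbrev WLp (d : ℕ) (γ q : ℝ) : Type := Lp ℝ (ENNReal.ofReal q) (weightedMeasure d γ)

/-- `g` is the gradient of `w` on `ℝ^d` in the sense of distributions. -/
structure HasWeakGradient {d : ℕ} (w : Space d → ℝ) (g : Space d → Space d) : Prop where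
  locInt : LocallyIntegrable w volume
  locInt_grad : LocallyIntegrable g volume
  integral_eq : ∀ φ : Space d → ℝ, ContDiff ℝ ∞ φ → HasCompactSupport φ → ∀ v : Space d,
    ∫ x, w x * fderiv ℝ φ x v = -∫ x, inner ℝ (g x) v * φ x

theorem HasWeakGradient.congr {d : ℕ} {w w' : Space d → ℝ} {g g' : Space d → Space d}
    (h : HasWeakGradient w g) (hw : w' =ᵐ[volume] w) (hg : g' =ᵐ[volume] g) :
    HasWeakGradient w' g' where
  locInt := h.locInt.congr hw.symm
  locInt_grad := h.locInt_grad.congr hg.symm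
  integral_eq φ h1 h2 v := by
    have e1 : ∫ x, w' x * fderiv ℝ φ x v = ∫ x, w x * fderiv ℝ φ x v :=
      integral_congr_ae (by filter_upwards [hw] with x hx; rw [hx])
    have e2 : ∫ x, inner ℝ (g' x) v * φ x = ∫ x, inner ℝ (g x) v * φ x :=
      integral_congr_ae (by filter_upwards [hg] with x hx; rw [hx])
    rw [e1, e2, h.integral_eq φ h1 h2 v]

theorem HasWeakGradient.integrable_left {d : ℕ} {w : Space d → ℝ} {g : Space d → Space d}
    (h : HasWeakGradient w g) {φ : Space d → ℝ} (h1 : ContDiff ℝ ∞ φ) (h2 : HasCompactSupport φ)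
    (v : Space d) : Integrable (fun x => w x * fderiv ℝ φ x v) volume := by
  have := h.locInt.integrable_smul_right_of_hasCompactSupport
    (g := fun x => fderiv ℝ φ x v)
    ((h1.continuous_fderiv (by simp)).clm_apply continuous_const)
    (h2.fderiv_apply (𝕜 := ℝ) v)
  simpa [smul_eq_mul] using this

theorem HasWeakGradient.integrable_right {d : ℕ} {w : Space d → ℝ} {g : Space d → Space d}
    (h : HasWeakGradient w g) {φ : Space d → ℝ} (h1 : ContDiff ℝ ∞ φ) (h2 : HasCompactSupport φ)
    (v : Space d) : Integrable (fun x => inner ℝ (g x) v * φ x) volume := by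
  have := h.locInt_grad.integrable_smul_left_of_hasCompactSupport h1.continuous h2
  refine (this.inner_const (𝕜 := ℝ) v).congr (Filter.Eventually.of_forall fun x => ?_)
  simp [real_inner_smul_left, mul_comm]

theorem HasWeakGradient.zero {d : ℕ} :
    HasWeakGradient (0 : Space d → ℝ) (0 : Space d → Space d) where
  locInt := locallyIntegrable_zero
  locInt_grad := locallyIntegrable_zero
  integral_eq φ _ _ v := by simp

theorem HasWeakGradient.add {d : ℕ} {w w' : Space d → ℝ} {g g' : Space d → Space d}
    (h : HasWeakGradient w g) (h' : HasWeakGradient w' g') :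
    HasWeakGradient (w + w') (g + g') where
  locInt := h.locInt.add h'.locInt
  locInt_grad := h.locInt_grad.add h'.locInt_grad
  integral_eq φ h1 h2 v := by
    simp only [Pi.add_apply, add_mul, inner_add_left]
    rw [integral_add (h.integrable_left h1 h2 v) (h'.integrable_left h1 h2 v),
      integral_add (h.integrable_right h1 h2 v) (h'.integrable_right h1 h2 v),
      h.integral_eq φ h1 h2 v, h'.integral_eq φ h1 h2 v]
    ring

theorem HasWeakGradient.smul {d : ℕ} {w : Space d → ℝ} {g : Space d → Space d}
    (h : HasWeakGradient w g) (c : ℝ) : HasWeakGradient (c • w) (c • g) where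
  locInt := h.locInt.smul c
  locInt_grad := h.locInt_grad.smul c
  integral_eq φ h1 h2 v := by
    simp only [Pi.smul_apply, smul_eq_mul, real_inner_smul_left, mul_assoc, integral_const_mul]
    rw [h.integral_eq φ h1 h2 v]
    ring

/-- Lebesgue measure and `|x|^{-γ} dx` have the same null sets. -/
theorem volume_absolutelyContinuous (d : ℕ) [hd : Fact (3 ≤ d)] (γ : ℝ) :
    (volume : Measure (Space d)) ≪ weightedMeasure d γ := by
  have : Nonempty (Fin d) := ⟨⟨0, by have := hd.out; omega⟩⟩
  refine withDensity_absolutelyContinuous' (by fun_prop) ?_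
  have h0 : ∀ᵐ x : Space d, x ≠ 0 := by
    simp [ae_iff]
  filter_upwards [h0] with x hx
  have : 0 < ‖x‖ ^ (-γ) := Real.rpow_pos_of_pos (norm_pos_iff.mpr hx) _
  simpa using this

instance fact_one_le_ofReal_add_one (p : ℝ) [hp : Fact (1 < p)] :
    Fact (1 ≤ ENNReal.ofReal (p + 1)) :=
  ⟨by rw [ENNReal.one_le_ofReal]; linarith [hp.out]⟩

instance fact_one_le_ofReal_two_mul (p : ℝ) [hp : Fact (1 < p)] :
    Fact (1 ≤ ENNReal.ofReal (2 * p)) :=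
  ⟨by rw [ENNReal.one_le_ofReal]; linarith [hp.out]⟩

/-- The space `H_{p,γ}(ℝ^d)` of functions `w ∈ L^{p+1}_γ` with distributional gradient in `L²`.
It is realised as the space of pairs `(w, ∇w)`; the norm inherited from the `ℓ¹` product is
`‖w‖_{p+1,γ} + ‖∇w‖_2`, see `norm_HSpace_eq`. -/
def HSpace (d : ℕ) [Fact (3 ≤ d)] (p γ : ℝ) [Fact (1 < p)] :
    Submodule ℝ (WithLp 1 (WLp d γ (p + 1) × Lp (Space d) 2 (volume : Measure (Space d)))) where
  carrier := {u | HasWeakGradient (u.fst : Space d → ℝ) (u.snd : Space d → Space d)}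
  zero_mem' := HasWeakGradient.zero.congr
    ((volume_absolutelyContinuous d γ).ae_eq (Lp.coeFn_zero _ _ _)) (Lp.coeFn_zero _ _ _)
  add_mem' {u v} hu hv := (HasWeakGradient.add hu hv).congr
    ((volume_absolutelyContinuous d γ).ae_eq (Lp.coeFn_add u.fst v.fst))
    (Lp.coeFn_add u.snd v.snd)
  smul_mem' c u hu := (HasWeakGradient.smul hu c).congr
    ((volume_absolutelyContinuous d γ).ae_eq (Lp.coeFn_smul c u.fst)) (Lp.coeFn_smul c u.snd)

section

variable {d : ℕ} [Fact (3 ≤ d)] {p γ : ℝ} [Fact (1 < p)]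

/-- The function underlying an element of `H_{p,γ}(ℝ^d)`. -/
def fn (w : HSpace d p γ) : Space d → ℝ := w.1.fst

/-- The gradient of an element of `H_{p,γ}(ℝ^d)`. -/
def grad (w : HSpace d p γ) : Space d → Space d := w.1.snd

theorem norm_WLp_eq {d : ℕ} {γ q : ℝ} (hq : 0 < q) (f : WLp d γ q) :
    ‖f‖ = wnorm q γ (f : Space d → ℝ) := by
  rw [Lp.norm_def, MemLp.eLpNorm_eq_integral_rpow_norm (by simpa using hq) (by simp) (Lp.memLp f),
    ENNReal.toReal_ofReal (by positivity), ENNReal.toReal_ofReal hq.le, wnorm, one_div]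
  congr 1
  generalize (f : Space d → ℝ) = f
  rw [weightedMeasure, integral_withDensity_eq_integral_toReal_smul (by fun_prop) (by simp)]
  refine integral_congr_ae (Filter.Eventually.of_forall fun x => ?_)
  simp only [smul_eq_mul]
  rw [ENNReal.toReal_ofReal (by positivity), mul_comm]

/-- The norm of `H_{p,γ}(ℝ^d)` is `‖w‖_{p+1,γ} + ‖∇w‖_2`. -/
theorem norm_HSpace_eq (w : HSpace d p γ) :
    ‖w‖ = wnorm (p + 1) γ (fn w) + wnorm 2 0 (grad w) := by
  have hp : (1 : ℝ) < p := Fact.out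
  have h := WithLp.prod_norm_eq_of_nat (p := 1) (n := 1) (by simp) w.1
  rw [Submodule.norm_coe] at h
  rw [h]
  simp only [pow_one, Nat.cast_one, one_div_one, Real.rpow_one]
  rw [norm_WLp_eq (by linarith)]
  congr 1
  rw [Lp.norm_def, MemLp.eLpNorm_eq_integral_rpow_norm (by simp) (by simp) (Lp.memLp _),
    ENNReal.toReal_ofReal (by positivity), wnorm, one_div]
  simp [grad]

/-- The functional `G_γ[w] = ½ ‖∇w‖_2² + 1/(p+1) ‖w‖_{p+1,γ}^{p+1}` on `H_{p,γ}(ℝ^d)`. -/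
def G (w : HSpace d p γ) : ℝ :=
  1 / 2 * wnorm 2 0 (grad w) ^ 2 + 1 / (p + 1) * wnorm (p + 1) γ (fn w) ^ (p + 1)

/-- The mass `‖w‖_{2p,γ}^{2p}`. -/
def mass (w : HSpace d p γ) : ℝ := wnorm (2 * p) γ (fn w) ^ (2 * p)

end

/-- The exponent `θ_γ`. -/
def theta (d : ℕ) (p γ : ℝ) : ℝ :=
  (d + 2 - 2 * γ - p * (d - 2)) / (d - γ - p * (d + γ - 4))

/-- The optimal constant `J_γ`, that is, the largest `C` such that
`G_γ[w] - C ‖w‖_{2p,γ}^{2 p θ_γ} ≥ 0` for all `w ∈ H_{p,γ}(ℝ^d)`. -/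
def J (d : ℕ) [Fact (3 ≤ d)] (p γ : ℝ) [Fact (1 < p)] : ℝ :=
  sSup {C : ℝ | ∀ w : HSpace d p γ,
    0 ≤ G w - C * wnorm (2 * p) γ (fn w) ^ (2 * p * theta d p γ)}

end CKN

end

/-!
On the unit ball `B` of `H_{p,γ}` the norms in `L^{p+1}_γ` and, by Sobolev's inequality, in
`L^{2^*}` are bounded, and `p + 1 < 2p < 2^*_γ < 2^*`. Since `|x|^{-γ}` is integrable to a power
larger than one near the origin and decays at infinity, Hölder's inequality makes the
`L^{2p}_γ`-mass of `B` near the origin and near infinity uniformly small. In between, averaging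
over the cells of a grid of side `h` is a finite rank operator that is uniformly `O(h)`-close to the
identity in `L²` on `B`, hence close to it in `L^{2p}` by interpolation with `L^{2^*}`. So the
inclusion into `L^{2p}_γ` is a limit of compact operators.

A minimizing sequence of prescribed mass therefore converges strongly in `L^{2p}_γ` along a
subsequence, and Fatou's lemma together with weak limits of gradients shows that its limit is a
minimizer. Finally a suitable scaling `w ↦ a w(l ·)` multiplies the mass by `m` and `G` by `m ^ θ`,
which gives the formula for `J`.
-/

namespace CKN

open Filter Set
open scoped Topology Convolution NNReal Gradient

section Jensen

variable {X Y F : Type*} [MeasurableSpace X] [MeasurableSpace Y] [NormedAddCommGroup F]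

theorem enorm_integral_rpow_le [NormedSpace ℝ F] (ν : Measure Y) [IsProbabilityMeasure ν]
    (f : Y → F) {q : ℝ} (hq : 1 ≤ q) : ‖∫ y, f y ∂ν‖ₑ ^ q ≤ ∫⁻ y, ‖f y‖ₑ ^ q ∂ν := by
  have hq0 : 0 < q := by linarith
  by_cases hf : AEStronglyMeasurable f ν
  · have hmean : ‖∫ y, f y ∂ν‖ₑ ≤ eLpNorm' f q ν := by
      refine (enorm_integral_le_lintegral_enorm f).trans ?_
      simpa [eLpNorm'] using eLpNorm'_le_eLpNorm'_of_exponent_le one_pos hq ν hf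
    calc ‖∫ y, f y ∂ν‖ₑ ^ q ≤ eLpNorm' f q ν ^ q := by gcongr
      _ = ∫⁻ y, ‖f y‖ₑ ^ q ∂ν := by
        rw [eLpNorm', ← ENNReal.rpow_mul, one_div, inv_mul_cancel₀ hq0.ne', ENNReal.rpow_one]
  · simp [integral_undef fun h : Integrable f ν => hf h.1, hq0]

theorem lintegral_enorm_integral_rpow_le_of_forall_le [NormedSpace ℝ F] {μ : Measure X} [SFinite μ]
    {ν : Measure Y} [IsProbabilityMeasure ν] {f : X → Y → F}
    (hf : AEStronglyMeasurable (Function.uncurry f) (μ.prod ν)) {q : ℝ} (hq : 1 ≤ q) {A : ℝ≥0∞}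
    (hA : ∀ y, ∫⁻ x, ‖f x y‖ₑ ^ q ∂μ ≤ A) : ∫⁻ x, ‖∫ y, f x y ∂ν‖ₑ ^ q ∂μ ≤ A :=
  calc ∫⁻ x, ‖∫ y, f x y ∂ν‖ₑ ^ q ∂μ ≤ ∫⁻ x, ∫⁻ y, ‖f x y‖ₑ ^ q ∂ν ∂μ :=
        lintegral_mono fun x => enorm_integral_rpow_le ν _ hq
    _ = ∫⁻ y, ∫⁻ x, ‖f x y‖ₑ ^ q ∂μ ∂ν := lintegral_lintegral_swap (hf.enorm.pow_const q)
    _ ≤ ∫⁻ _, A ∂ν := lintegral_mono hA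
    _ = A := by simp

theorem lintegral_enorm_rpow_le_of_tendsto {μ : Measure X} {f : ℕ → X → F} {f₀ : X → F}
    (hf : ∀ n, AEStronglyMeasurable (f n) μ)
    (hlim : ∀ᵐ x ∂μ, Tendsto (fun n => f n x) atTop (𝓝 (f₀ x))) {q : ℝ} {A : ℝ≥0∞}
    (hA : ∀ n, ∫⁻ x, ‖f n x‖ₑ ^ q ∂μ ≤ A) : ∫⁻ x, ‖f₀ x‖ₑ ^ q ∂μ ≤ A :=
  calc ∫⁻ x, ‖f₀ x‖ₑ ^ q ∂μ = ∫⁻ x, liminf (fun n => ‖f n x‖ₑ ^ q) atTop ∂μ := by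
        refine lintegral_congr_ae ?_
        filter_upwards [hlim] with x hx
        exact ((ENNReal.continuous_rpow_const.tendsto _).comp hx.enorm).liminf_eq.symm
    _ ≤ liminf (fun n => ∫⁻ x, ‖f n x‖ₑ ^ q ∂μ) atTop :=
        lintegral_liminf_le' fun n => (hf n).enorm.pow_const q
    _ ≤ A := (liminf_le_liminf (Eventually.of_forall hA)).trans (by simp)

end Jensen

section Mollification

theorem lintegral_enorm_convolution_rpow_le {E F : Type*} [AddGroup E] [MeasurableSpace E]
    [MeasurableAdd₂ E] [MeasurableNeg E] {μ : Measure E} [SFinite μ] [μ.IsAddRightInvariant]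
    [NormedAddCommGroup F] [NormedSpace ℝ F] {ρ : E → ℝ} (hρm : Measurable ρ)
    (hρ0 : ∀ x, 0 ≤ ρ x) (hρ1 : ∫⁻ x, ENNReal.ofReal (ρ x) ∂μ = 1)
    {g : E → F} (hg : AEStronglyMeasurable g μ) {q : ℝ} (hq : 1 ≤ q) :
    ∫⁻ x, ‖(ρ ⋆[ContinuousLinearMap.lsmul ℝ ℝ, μ] g) x‖ₑ ^ q ∂μ ≤ ∫⁻ x, ‖g x‖ₑ ^ q ∂μ := by
  let ν := μ.withDensity fun t => ENNReal.ofReal (ρ t)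
  have : IsProbabilityMeasure ν := ⟨by simpa [ν] using hρ1⟩
  have hconv (x : E) : (ρ ⋆[ContinuousLinearMap.lsmul ℝ ℝ, μ] g) x = ∫ t, g (x - t) ∂ν := by
    rw [integral_withDensity_eq_integral_toReal_smul hρm.ennreal_ofReal (by simp)]
    simp [convolution, ENNReal.toReal_ofReal (hρ0 _)]
  simp_rw [hconv]
  refine lintegral_enorm_integral_rpow_le_of_forall_le (f := fun x t => g (x - t))
    (hg.comp_quasiMeasurePreserving (quasiMeasurePreserving_sub_of_right_invariant μ ν)) hq
    fun t => ?_
  rw [lintegral_sub_right_eq_self (fun x => ‖g x‖ₑ ^ q)]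

variable {d : ℕ}

theorem fderiv_comp_const_sub {E F : Type*} [NormedAddCommGroup E] [NormedSpace ℝ E]
    [NormedAddCommGroup F] [NormedSpace ℝ F] {f : E → F} (hf : Differentiable ℝ f) (x t : E) :
    fderiv ℝ (fun t => f (x - t)) t = -fderiv ℝ f (x - t) := by
  have hsub : HasFDerivAt (fun t : E => x - t) (-ContinuousLinearMap.id ℝ E) t := by
    simpa using (hasFDerivAt_id t).const_sub x
  have hcomp := ((hf (x - t)).hasFDerivAt.comp t hsub).fderiv
  rwa [ContinuousLinearMap.comp_neg, ContinuousLinearMap.comp_id] at hcomp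

theorem HasWeakGradient.integral_fderiv_comp_const_sub {w : Space d → ℝ} {g : Space d → Space d}
    (h : HasWeakGradient w g) {φ : Space d → ℝ} (hφ : ContDiff ℝ ∞ φ) (hφc : HasCompactSupport φ)
    (x v : Space d) :
    ∫ t, w t * fderiv ℝ φ (x - t) v = ∫ t, inner ℝ (g t) v * φ (x - t) := by
  have hparts := h.integral_eq (fun t => φ (x - t)) (hφ.comp (by fun_prop))
    (hφc.comp_homeomorph (Homeomorph.subLeft x)) v
  simpa only [fderiv_comp_const_sub (hφ.differentiable (by simp)), neg_apply,
    mul_neg, integral_neg, neg_inj] using hparts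

theorem HasWeakGradient.gradient_convolution {w : Space d → ℝ} {g : Space d → Space d}
    (h : HasWeakGradient w g) {φ : Space d → ℝ} (hφ : ContDiff ℝ ∞ φ) (hφc : HasCompactSupport φ)
    (x : Space d) :
    ∇ (φ ⋆[ContinuousLinearMap.lsmul ℝ ℝ, volume] w) x
      = (φ ⋆[ContinuousLinearMap.lsmul ℝ ℝ, volume] g) x := by
  refine ext_inner_right ℝ fun v => ?_
  have hderiv := hφc.hasFDerivAt_convolution_left (ContinuousLinearMap.lsmul ℝ ℝ)
    (hφ.of_le (by simp)) h.locInt x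
  have hw := (hφc.fderiv (𝕜 := ℝ)).convolutionExists_left
    ((ContinuousLinearMap.lsmul ℝ ℝ : ℝ →L[ℝ] ℝ →L[ℝ] ℝ).precompL (Space d))
    (hφ.continuous_fderiv (by simp)) h.locInt x
  have hg := hφc.convolutionExists_left (ContinuousLinearMap.lsmul ℝ ℝ)
    hφ.continuous h.locInt_grad x
  calc inner ℝ (∇ (φ ⋆[ContinuousLinearMap.lsmul ℝ ℝ, volume] w) x) v
      = ∫ t, w (x - t) * fderiv ℝ φ t v := by
        rw [gradient, InnerProductSpace.toDual_symm_apply, hderiv.fderiv, convolution,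
          ContinuousLinearMap.integral_apply hw]
        simp [ContinuousLinearMap.precompL_apply, mul_comm]
    _ = ∫ t, w t * fderiv ℝ φ (x - t) v := by
        rw [← integral_sub_left_eq_self _ volume x]
        simp only [sub_sub_cancel]
    _ = ∫ t, inner ℝ (g t) v * φ (x - t) := h.integral_fderiv_comp_const_sub hφ hφc x v
    _ = ∫ t, inner ℝ (g (x - t)) v * φ t := by
        rw [← integral_sub_left_eq_self _ volume x]
        simp only [sub_sub_cancel]
    _ = inner ℝ ((φ ⋆[ContinuousLinearMap.lsmul ℝ ℝ, volume] g) x) v := by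
        rw [convolution, real_inner_comm, ← integral_inner hg]
        simp [real_inner_smul_right, real_inner_comm, mul_comm]

theorem HasWeakGradient.exists_seq_contDiff {w : Space d → ℝ} {g : Space d → Space d}
    (h : HasWeakGradient w g) :
    ∃ u : ℕ → Space d → ℝ, (∀ n, ContDiff ℝ ∞ (u n)) ∧
      (∀ᵐ x, Tendsto (fun n => u n x) atTop (𝓝 (w x))) ∧
      (∀ n, ∀ q : ℝ, 1 ≤ q → ∫⁻ x, ‖∇ (u n) x‖ₑ ^ q ≤ ∫⁻ x, ‖g x‖ₑ ^ q) ∧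
      (HasCompactSupport w → ∀ n, HasCompactSupport (u n)) := by
  let φ : ℕ → ContDiffBump (0 : Space d) := fun n =>
    ⟨1 / ((n : ℝ) + 1), 2 * (1 / ((n : ℝ) + 1)), by positivity,
      lt_two_mul_self (by positivity)⟩
  refine ⟨fun n => (φ n).normed volume ⋆[ContinuousLinearMap.lsmul ℝ ℝ, volume] w,
    fun n => ?_, ?_, fun n q hq => ?_, fun hw n => ?_⟩
  · exact (φ n).hasCompactSupport_normed.contDiff_convolution_left _ (φ n).contDiff_normed h.locInt
  · refine ContDiffBump.ae_convolution_tendsto_right_of_locallyIntegrable (K := 2) ?_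
      (Eventually.of_forall fun n => le_rfl) h.locInt
    simpa only [mul_zero] using
      (tendsto_one_div_add_atTop_nhds_zero_nat (𝕜 := ℝ)).const_mul 2
  · simp_rw [h.gradient_convolution (φ n).contDiff_normed (φ n).hasCompactSupport_normed]
    refine lintegral_enorm_convolution_rpow_le (φ n).continuous_normed.measurable
      (φ n).nonneg_normed ?_ h.locInt_grad.aestronglyMeasurable hq
    rw [← ofReal_integral_eq_lintegral_ofReal (φ n).integrable_normed
      (Eventually.of_forall (φ n).nonneg_normed), (φ n).integral_normed, ENNReal.ofReal_one]
  · exact (φ n).hasCompactSupport_normed.convolution _ hw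

end Mollification

section Translation

theorem sub_eq_integral_fderiv {E F : Type*} [NormedAddCommGroup E] [NormedSpace ℝ E]
    [NormedAddCommGroup F] [NormedSpace ℝ F] [CompleteSpace F] {u : E → F} (hu : ContDiff ℝ 1 u)
    (x z : E) : u (x + z) - u x = ∫ t in Ioc (0 : ℝ) 1, fderiv ℝ u (x + t • z) z := by
  have hderiv (t : ℝ) : HasDerivAt (fun t : ℝ => u (x + t • z)) (fderiv ℝ u (x + t • z) z) t := by
    have hline : HasDerivAt (fun t : ℝ => x + t • z) z t := by
      simpa using ((hasDerivAt_id t).smul_const z).const_add x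
    exact (hu.differentiable (by simp) _).hasFDerivAt.comp_hasDerivAt t hline
  have hcont : Continuous fun t : ℝ => fderiv ℝ u (x + t • z) z :=
    ((hu.continuous_fderiv (by simp)).comp (by fun_prop)).clm_apply continuous_const
  have hftc := intervalIntegral.integral_eq_sub_of_hasDerivAt (fun t _ => hderiv t)
    (hcont.intervalIntegrable 0 1)
  rw [intervalIntegral.integral_of_le zero_le_one] at hftc
  simpa using hftc.symm

theorem lintegral_enorm_translate_sub_rpow_le {E F : Type*} [NormedAddCommGroup E]
    [NormedSpace ℝ E] [MeasurableSpace E] [BorelSpace E] [SecondCountableTopology E]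
    {μ : Measure E} [SFinite μ] [μ.IsAddRightInvariant] [NormedAddCommGroup F] [NormedSpace ℝ F]
    [CompleteSpace F] {u : E → F} (hu : ContDiff ℝ 1 u) (z : E) {q : ℝ} (hq : 1 ≤ q) :
    ∫⁻ x, ‖u (x + z) - u x‖ₑ ^ q ∂μ ≤ ‖z‖ₑ ^ q * ∫⁻ x, ‖fderiv ℝ u x‖ₑ ^ q ∂μ := by
  have hq0 : 0 ≤ q := by linarith
  have hcont : Continuous (fderiv ℝ u) := hu.continuous_fderiv (by simp)
  have : IsProbabilityMeasure ((volume : Measure ℝ).restrict (Ioc 0 1)) := ⟨by simp⟩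
  simp_rw [sub_eq_integral_fderiv hu]
  refine lintegral_enorm_integral_rpow_le_of_forall_le (Continuous.aestronglyMeasurable ?_) hq
    fun t => ?_
  · exact (hcont.comp (by fun_prop)).clm_apply continuous_const
  · calc ∫⁻ x, ‖fderiv ℝ u (x + t • z) z‖ₑ ^ q ∂μ
        ≤ ∫⁻ x, ‖z‖ₑ ^ q * ‖fderiv ℝ u (x + t • z)‖ₑ ^ q ∂μ := by
          refine lintegral_mono fun x => ?_
          rw [← ENNReal.mul_rpow_of_nonneg _ _ hq0, mul_comm]
          gcongr
          exact ContinuousLinearMap.le_opENorm _ _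
      _ = ‖z‖ₑ ^ q * ∫⁻ x, ‖fderiv ℝ u x‖ₑ ^ q ∂μ := by
          rw [lintegral_const_mul' _ _ (by simp [hq0]),
            lintegral_add_right_eq_self (fun x => ‖fderiv ℝ u x‖ₑ ^ q)]

variable {d : ℕ}

theorem enorm_gradient (f : Space d → ℝ) (x : Space d) : ‖∇ f x‖ₑ = ‖fderiv ℝ f x‖ₑ := by
  rw [← toDual_gradient, LinearIsometryEquiv.enorm_map]

theorem HasWeakGradient.lintegral_enorm_translate_sub_rpow_le {w : Space d → ℝ}
    {g : Space d → Space d} (h : HasWeakGradient w g) (z : Space d) {q : ℝ} (hq : 1 ≤ q) :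
    ∫⁻ x, ‖w (x + z) - w x‖ₑ ^ q ≤ ‖z‖ₑ ^ q * ∫⁻ x, ‖g x‖ₑ ^ q := by
  obtain ⟨u, hu, hlim, hgrad, -⟩ := h.exists_seq_contDiff
  have hlim_translate : ∀ᵐ x, Tendsto (fun n => u n (x + z)) atTop (𝓝 (w (x + z))) :=
    (quasiMeasurePreserving_add_right volume z).ae hlim
  refine lintegral_enorm_rpow_le_of_tendsto (f := fun n x => u n (x + z) - u n x) (fun n => ?_) ?_
    fun n => ?_
  · have := (hu n).continuous
    exact Continuous.aestronglyMeasurable (by fun_prop)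
  · filter_upwards [hlim, hlim_translate] with x hx hxz using hxz.sub hx
  · refine (CKN.lintegral_enorm_translate_sub_rpow_le ((hu n).of_le (by simp)) z hq).trans ?_
    simp_rw [← enorm_gradient]
    exact mul_le_mul_right (hgrad n q hq) _

end Translation

section Smooth

variable {d : ℕ}

theorem continuous_gradient {φ : Space d → ℝ} (hφ : ContDiff ℝ 1 φ) : Continuous (∇ φ) :=
  (InnerProductSpace.toDual ℝ (Space d)).symm.continuous.comp (hφ.continuous_fderiv (by simp))

theorem hasWeakGradient_gradient {φ : Space d → ℝ} (hφ : ContDiff ℝ 1 φ) :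
    HasWeakGradient φ (∇ φ) where
  locInt := hφ.continuous.locallyIntegrable
  locInt_grad := (continuous_gradient hφ).locallyIntegrable
  integral_eq ψ hψ hψc v := by
    have hψd : Continuous fun x => fderiv ℝ ψ x v :=
      (hψ.continuous_fderiv (by simp)).clm_apply continuous_const
    have hφd : Continuous fun x => fderiv ℝ φ x v :=
      (hφ.continuous_fderiv (by simp)).clm_apply continuous_const
    simp only [gradient, InnerProductSpace.toDual_symm_apply]
    exact integral_mul_fderiv_eq_neg_fderiv_mul_of_integrable
      ((hφd.mul hψ.continuous).integrable_of_hasCompactSupport hψc.mul_left)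
      ((hφ.continuous.mul hψd).integrable_of_hasCompactSupport (hψc.fderiv_apply ℝ v).mul_left)
      ((hφ.continuous.mul hψ.continuous).integrable_of_hasCompactSupport hψc.mul_left)
      (fun x _ => hφ.differentiable (by simp) x) fun x _ => hψ.differentiable (by simp) x

theorem HasWeakGradient.smooth_mul {w : Space d → ℝ} {g : Space d → Space d}
    (h : HasWeakGradient w g) {χ : Space d → ℝ} (hχ : ContDiff ℝ ∞ χ) :
    HasWeakGradient (fun x => χ x * w x) (fun x => χ x • g x + w x • ∇ χ x) where
  locInt := h.locInt.continuous_smul hχ.continuous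
  locInt_grad := (h.locInt_grad.continuous_smul hχ.continuous).add
    (h.locInt.smul_continuous (continuous_gradient (hχ.of_le (by simp))))
  integral_eq φ hφ hφc v := by
    have hχφ : ContDiff ℝ ∞ fun x => χ x * φ x := hχ.mul hφ
    have hχφc : HasCompactSupport fun x => χ x * φ x := hφc.mul_left
    have hint : Integrable fun x => w x * (φ x * fderiv ℝ χ x v) := by
      have hχd : Continuous fun x => fderiv ℝ χ x v :=
        (hχ.continuous_fderiv (by simp)).clm_apply continuous_const
      exact h.locInt.integrable_smul_right_of_hasCompactSupport (hφ.continuous.mul hχd)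
        hφc.mul_right
    have hprod (x : Space d) : fderiv ℝ (fun x => χ x * φ x) x v
        = χ x * fderiv ℝ φ x v + φ x * fderiv ℝ χ x v := by
      rw [fderiv_fun_mul (hχ.differentiable (by simp) x) (hφ.differentiable (by simp) x)]
      simp
    calc ∫ x, χ x * w x * fderiv ℝ φ x v
        = ∫ x, (w x * fderiv ℝ (fun x => χ x * φ x) x v - w x * (φ x * fderiv ℝ χ x v)) := by
          congr 1 with x
          rw [hprod]
          ring
      _ = -((∫ x, inner ℝ (g x) v * (χ x * φ x)) + ∫ x, w x * (φ x * fderiv ℝ χ x v)) := by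
          rw [integral_sub (h.integrable_left hχφ hχφc v) hint, h.integral_eq _ hχφ hχφc v]
          ring
      _ = -∫ x, inner ℝ (χ x • g x + w x • ∇ χ x) v * φ x := by
          rw [← integral_add (h.integrable_right hχφ hχφc v) hint]
          congr 2 with x
          simp only [gradient, inner_add_left, real_inner_smul_left,
            InnerProductSpace.toDual_symm_apply]
          ring

end Smooth

section Weight

variable {d : ℕ} [NeZero d] {γ : ℝ}

theorem ae_ne_zero : ∀ᵐ x : Space d, x ≠ 0 := by
  simp [ae_iff]

theorem restrict_ball_le_weightedMeasure (hγ : 0 ≤ γ) (ρ : ℝ) :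
    (volume : Measure (Space d)).restrict (Metric.ball 0 ρ)
      ≤ ENNReal.ofReal (ρ ^ γ) • weightedMeasure d γ := by
  rw [weightedMeasure, ← withDensity_smul _ (by fun_prop), ← withDensity_indicator_one
    measurableSet_ball]
  refine withDensity_mono ?_
  filter_upwards [ae_ne_zero] with x hx
  refine indicator_apply_le fun hxρ => ?_
  have hx0 : 0 < ‖x‖ := norm_pos_iff.2 hx
  have hxρ : ‖x‖ < ρ := by simpa using hxρ
  have hρ0 : 0 < ρ := hx0.trans hxρ
  simp only [Pi.one_apply, Pi.smul_apply, smul_eq_mul]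
  rw [← ENNReal.ofReal_mul (by positivity), ENNReal.one_le_ofReal, Real.rpow_neg hx0.le,
    ← div_eq_mul_inv, one_le_div (by positivity)]
  exact Real.rpow_le_rpow hx0.le hxρ.le hγ

theorem eLpNorm_restrict_ball_le (hγ : 0 ≤ γ) {ρ : ℝ} (hρ : 0 < ρ) {q : ℝ} (hq : 0 < q)
    {F : Type*} [NormedAddCommGroup F] (w : Space d → F) :
    eLpNorm w (ENNReal.ofReal q) (volume.restrict (Metric.ball 0 ρ))
      ≤ ENNReal.ofReal (ρ ^ (γ / q)) * eLpNorm w (ENNReal.ofReal q) (weightedMeasure d γ) := by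
  refine (eLpNorm_mono_measure _ (restrict_ball_le_weightedMeasure hγ ρ)).trans ?_
  rw [eLpNorm_smul_measure_of_ne_top (by simp), ENNReal.toReal_div, ENNReal.toReal_ofReal hq.le,
    smul_eq_mul, ENNReal.toReal_one, ENNReal.ofReal_rpow_of_pos (by positivity),
    ← Real.rpow_mul hρ.le]
  simp [div_eq_mul_inv]

theorem eLpNorm_restrict_ball_le_of_exponent_le (hγ : 0 ≤ γ) {ρ : ℝ} (hρ : 0 < ρ) {s q : ℝ}
    (hs : 0 < s) (hsq : s ≤ q) {F : Type*} [NormedAddCommGroup F] {w : Space d → F}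
    (hw : AEStronglyMeasurable w) :
    eLpNorm w (ENNReal.ofReal s) (volume.restrict (Metric.ball 0 ρ))
      ≤ ENNReal.ofReal (ρ ^ (γ / q + d * (1 / s - 1 / q)))
        * volume (Metric.ball (0 : Space d) 1) ^ (1 / s - 1 / q)
        * eLpNorm w (ENNReal.ofReal q) (weightedMeasure d γ) := by
  have hq : 0 < q := hs.trans_le hsq
  have ha : 0 ≤ 1 / s - 1 / q := sub_nonneg.2 (one_div_le_one_div_of_le hs hsq)
  have hholder := eLpNorm_le_eLpNorm_mul_rpow_measure_univ
    (μ := volume.restrict (Metric.ball (0 : Space d) ρ)) (f := w)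
    (ENNReal.ofReal_le_ofReal hsq) hw.restrict
  rw [Measure.restrict_apply_univ, Measure.addHaar_ball_of_pos _ _ hρ,
    ENNReal.toReal_ofReal hq.le, ENNReal.toReal_ofReal hs.le, ENNReal.mul_rpow_of_nonneg _ _ ha,
    ENNReal.ofReal_rpow_of_pos (by positivity), finrank_euclideanSpace, Fintype.card_fin,
    ← Real.rpow_natCast, ← Real.rpow_mul hρ.le] at hholder
  refine hholder.trans ((mul_le_mul_left (eLpNorm_restrict_ball_le hγ hρ hq w) _).trans_eq ?_)
  rw [Real.rpow_add hρ, ENNReal.ofReal_mul (by positivity)]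
  ring

end Weight

section Cutoff

/-- The bump function generating the cutoffs `cutoff`: it is `1` on the unit ball and supported in
the ball of radius `2`. -/
def cutoffBump (d : ℕ) : ContDiffBump (0 : Space d) := ⟨1, 2, one_pos, one_lt_two⟩

/-- The smooth cutoff at scale `ρ`, used to reduce the Sobolev inequality to compactly supported
functions. -/
noncomputable def cutoff {d : ℕ} (ρ : ℝ) (x : Space d) : ℝ := cutoffBump d (ρ⁻¹ • x)

variable {d : ℕ} {ρ : ℝ}

theorem contDiff_cutoff (ρ : ℝ) : ContDiff ℝ ∞ (cutoff ρ : Space d → ℝ) :=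
  (cutoffBump d).contDiff.comp (contDiff_const_smul _)

theorem hasCompactSupport_cutoff (hρ : ρ ≠ 0) : HasCompactSupport (cutoff ρ : Space d → ℝ) :=
  (cutoffBump d).hasCompactSupport.comp_homeomorph (Homeomorph.smulOfNeZero _ (inv_ne_zero hρ))

theorem norm_cutoff_le_one (ρ : ℝ) (x : Space d) : ‖cutoff ρ x‖ ≤ 1 := by
  rw [cutoff, Real.norm_of_nonneg (cutoffBump d).nonneg]
  exact (cutoffBump d).le_one

theorem cutoff_eq_one (hρ : 0 < ρ) {x : Space d} (hx : ‖x‖ ≤ ρ) : cutoff ρ x = 1 := by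
  refine (cutoffBump d).one_of_mem_closedBall ?_
  rw [mem_closedBall_zero_iff, norm_smul, norm_inv, Real.norm_of_nonneg hρ.le,
    inv_mul_le_iff₀ hρ]
  simpa [cutoffBump] using hx

theorem tendsto_cutoff_mul (w : Space d → ℝ) (x : Space d) :
    Tendsto (fun n : ℕ => cutoff (n + 1) x * w x) atTop (𝓝 (w x)) := by
  obtain ⟨N, hN⟩ := exists_nat_ge ‖x‖
  refine tendsto_const_nhds.congr' ?_
  filter_upwards [eventually_ge_atTop N] with n hn
  have hxn : ‖x‖ ≤ n + 1 := by
    have : (N : ℝ) ≤ n := by exact_mod_cast hn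
    linarith
  rw [cutoff_eq_one (by positivity) hxn, one_mul]

theorem gradient_cutoff (ρ : ℝ) (x : Space d) :
    ∇ (cutoff ρ) x = ρ⁻¹ • ∇ (cutoffBump d) (ρ⁻¹ • x) := by
  have hsmul : fderiv ℝ (cutoff ρ) x = ρ⁻¹ • fderiv ℝ (cutoffBump d) (ρ⁻¹ • x) :=
    fderiv_comp_smul _
  simp [gradient, hsmul]

theorem gradient_cutoff_eq_zero (hρ : 0 < ρ) {x : Space d} (hx : x ∉ Metric.ball 0 (3 * ρ)) :
    ∇ (cutoff ρ) x = 0 := by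
  have hzero : fderiv ℝ (cutoffBump d) (ρ⁻¹ • x) = 0 := by
    refine image_eq_zero_of_notMem_tsupport fun hmem => hx ?_
    have hmem := tsupport_fderiv_subset ℝ (f := cutoffBump d) hmem
    rw [(cutoffBump d).tsupport_eq, mem_closedBall_zero_iff, norm_smul, norm_inv,
      Real.norm_of_nonneg hρ.le, inv_mul_le_iff₀ hρ, show (cutoffBump d).rOut = 2 from rfl] at hmem
    rw [mem_ball_zero_iff]
    linarith
  rw [gradient_cutoff, gradient, hzero, map_zero, smul_zero]

theorem exists_norm_gradient_cutoff_le (d : ℕ) :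
    ∃ K : ℝ, 0 ≤ K ∧ ∀ ρ : ℝ, 0 < ρ → ∀ x : Space d, ‖∇ (cutoff ρ) x‖ ≤ K / ρ := by
  obtain ⟨K, hK⟩ := ((cutoffBump d).hasCompactSupport.fderiv (𝕜 := ℝ)).exists_bound_of_continuous
    ((cutoffBump d).contDiff.continuous_fderiv (n := 1) (by simp))
  refine ⟨K, (norm_nonneg _).trans (hK 0), fun ρ hρ x => ?_⟩
  rw [gradient_cutoff, norm_smul, norm_inv, Real.norm_of_nonneg hρ.le, div_eq_inv_mul, gradient,
    LinearIsometryEquiv.norm_map]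
  gcongr
  exact hK _

theorem eLpNorm_smul_gradient_cutoff_le (hρ : 0 < ρ) {K : ℝ}
    (hK : ∀ x : Space d, ‖∇ (cutoff ρ) x‖ ≤ K) (w : Space d → ℝ) (s : ℝ≥0∞) :
    eLpNorm (fun x => w x • ∇ (cutoff ρ) x) s volume
      ≤ ENNReal.ofReal K * eLpNorm w s (volume.restrict (Metric.ball 0 (3 * ρ))) := by
  rw [← eLpNorm_indicator_eq_eLpNorm_restrict measurableSet_ball]
  refine eLpNorm_le_mul_eLpNorm_of_ae_le_mul (Eventually.of_forall fun x => ?_) s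
  rw [norm_smul]
  by_cases hx : x ∈ Metric.ball (0 : Space d) (3 * ρ)
  · rw [indicator_of_mem hx, mul_comm]
    exact mul_le_mul_of_nonneg_right (hK x) (norm_nonneg _)
  · simp [gradient_cutoff_eq_zero hρ hx, hx]

theorem div_add_mul_one_div_sub_le_one {d γ q : ℝ} (hq : 0 < q)
    (hq' : q * (d - 2) ≤ 2 * (d - γ)) : γ / q + d * (1 / 2 - 1 / q) ≤ 1 := by
  have : γ / q + d * (1 / 2 - 1 / q) = 1 + (q * (d - 2) - 2 * (d - γ)) / (2 * q) := by
    field_simp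
    ring
  rw [this]
  linarith [div_nonpos_of_nonpos_of_nonneg (sub_nonpos.2 hq') (by linarith : 0 ≤ 2 * q)]

theorem exists_eLpNorm_smul_gradient_cutoff_le [NeZero d] {γ : ℝ} (hγ : 0 ≤ γ) {q : ℝ}
    (hq : 2 ≤ q) (hq' : q * (d - 2) ≤ 2 * (d - γ)) :
    ∃ C : ℝ≥0, ∀ (ρ : ℝ) (w : Space d → ℝ), 1 ≤ ρ → AEStronglyMeasurable w →
      eLpNorm (fun x => w x • ∇ (cutoff ρ) x) 2 volume
        ≤ C * eLpNorm w (ENNReal.ofReal q) (weightedMeasure d γ) := by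
  obtain ⟨K, hK0, hK⟩ := exists_norm_gradient_cutoff_le d
  have ha : 0 ≤ 1 / 2 - 1 / q := sub_nonneg.2 (one_div_le_one_div_of_le two_pos hq)
  set V := volume (Metric.ball (0 : Space d) 1) ^ (1 / 2 - 1 / q)
  have hV : V ≠ ⊤ := ENNReal.rpow_ne_top_of_nonneg ha measure_ball_lt_top.ne
  refine ⟨(3 * K).toNNReal * V.toNNReal, fun ρ w hρ1 hw => ?_⟩
  have hρ : 0 < ρ := by linarith
  have hscale : K / ρ * (3 * ρ) ^ (γ / q + d * (1 / 2 - 1 / q)) ≤ 3 * K :=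
    calc K / ρ * (3 * ρ) ^ (γ / q + d * (1 / 2 - 1 / q)) ≤ K / ρ * (3 * ρ) ^ (1 : ℝ) := by
          gcongr
          · linarith
          · exact div_add_mul_one_div_sub_le_one (by linarith) hq'
      _ = 3 * K := by
          rw [Real.rpow_one]
          field_simp
  have hball := eLpNorm_restrict_ball_le_of_exponent_le hγ (by linarith : 0 < 3 * ρ) two_pos hq hw
  rw [ENNReal.ofReal_ofNat] at hball
  calc eLpNorm (fun x => w x • ∇ (cutoff ρ) x) 2 volume
      ≤ ENNReal.ofReal (K / ρ) * (ENNReal.ofReal ((3 * ρ) ^ (γ / q + d * (1 / 2 - 1 / q))) * V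
        * eLpNorm w (ENNReal.ofReal q) (weightedMeasure d γ)) :=
        (eLpNorm_smul_gradient_cutoff_le hρ (hK ρ hρ) w 2).trans (mul_le_mul_right hball _)
    _ = ENNReal.ofReal (K / ρ * (3 * ρ) ^ (γ / q + d * (1 / 2 - 1 / q))) * V
        * eLpNorm w (ENNReal.ofReal q) (weightedMeasure d γ) := by
        rw [ENNReal.ofReal_mul (by positivity)]
        ring
    _ ≤ _ := by
        push_cast
        rw [ENNReal.coe_toNNReal hV]
        gcongr
        exact ENNReal.ofReal_le_ofReal hscale

end Cutoff

section Sobolev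

variable {d : ℕ} [Fact (3 ≤ d)]

instance neZero_of_three_le : NeZero d :=
  ⟨by have := Fact.out (p := 3 ≤ d); omega⟩

theorem three_le_natCast (d : ℕ) [Fact (3 ≤ d)] : (3 : ℝ) ≤ d := by
  exact_mod_cast Fact.out (p := 3 ≤ d)

/-- The critical Sobolev exponent `2^* = 2d/(d-2)`. -/
noncomputable def sobolevExp (d : ℕ) : ℝ := 2 * d / (d - 2)

theorem HasWeakGradient.exists_eLpNorm_sobolevExp_le_of_hasCompactSupport (d : ℕ) [Fact (3 ≤ d)] :
    ∃ C : ℝ≥0, ∀ (w : Space d → ℝ) (g : Space d → Space d), HasWeakGradient w g →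
      HasCompactSupport w →
        eLpNorm w (ENNReal.ofReal (sobolevExp d)) volume ≤ C * eLpNorm g 2 volume := by
  have hd := three_le_natCast d
  refine ⟨eLpNormLESNormFDerivOfEqInnerConst (volume : Measure (Space d)) 2, fun w g h hw => ?_⟩
  obtain ⟨u, hu, hlim, hgrad, hcompact⟩ := h.exists_seq_contDiff
  have hgrad_two (n : ℕ) : eLpNorm (fderiv ℝ (u n)) 2 volume ≤ eLpNorm g 2 volume := by
    rw [eLpNorm_eq_lintegral_rpow_enorm_toReal (by simp) (by simp),
      eLpNorm_eq_lintegral_rpow_enorm_toReal (by simp) (by simp)]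
    simp only [ENNReal.toReal_ofNat, ← enorm_gradient]
    gcongr ?_ ^ _
    exact hgrad n 2 one_le_two
  have hexp : ((sobolevExp d).toNNReal : ℝ)⁻¹ = (2 : ℝ)⁻¹ - (d : ℝ)⁻¹ := by
    have hd2 : (d : ℝ) - 2 ≠ 0 := by linarith
    rw [Real.coe_toNNReal _ (by unfold sobolevExp; apply div_nonneg <;> linarith), sobolevExp]
    field_simp
  have hsmooth (n : ℕ) : eLpNorm (u n) (ENNReal.ofReal (sobolevExp d)) volume
      ≤ eLpNormLESNormFDerivOfEqInnerConst (volume : Measure (Space d)) 2 * eLpNorm g 2 volume :=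
    (eLpNorm_le_eLpNorm_fderiv_of_eq_inner (volume : Measure (Space d)) ((hu n).of_le (by simp))
      (hcompact hw n) (p := 2) (p' := (sobolevExp d).toNNReal) (by norm_num)
      (by simp; linarith [Fact.out (p := 3 ≤ d)]) (by simpa using hexp)).trans
      (mul_le_mul_right (hgrad_two n) _)
  calc eLpNorm w (ENNReal.ofReal (sobolevExp d)) volume
      ≤ liminf (fun n => eLpNorm (u n) (ENNReal.ofReal (sobolevExp d)) volume) atTop :=
        Lp.eLpNorm_lim_le_liminf_eLpNorm (fun n => (hu n).continuous.aestronglyMeasurable) _ hlim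
    _ ≤ _ := (liminf_le_liminf (Eventually.of_forall hsmooth)).trans (by simp)

theorem HasWeakGradient.exists_eLpNorm_sobolevExp_le {γ : ℝ} (hγ : 0 ≤ γ) {q : ℝ} (hq : 2 ≤ q)
    (hq' : q * (d - 2) ≤ 2 * (d - γ)) :
    ∃ C : ℝ≥0, ∀ (w : Space d → ℝ) (g : Space d → Space d), HasWeakGradient w g →
      eLpNorm w (ENNReal.ofReal (sobolevExp d)) volume
        ≤ C * (eLpNorm w (ENNReal.ofReal q) (weightedMeasure d γ) + eLpNorm g 2 volume) := by
  obtain ⟨C₀, hC₀⟩ := exists_eLpNorm_sobolevExp_le_of_hasCompactSupport d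
  obtain ⟨C₁, hC₁⟩ := exists_eLpNorm_smul_gradient_cutoff_le hγ hq hq'
  refine ⟨C₀ * max 1 C₁, fun w g h => ?_⟩
  have hw : AEStronglyMeasurable w := h.locInt.aestronglyMeasurable
  have hg : AEStronglyMeasurable g := h.locInt_grad.aestronglyMeasurable
  have hbound (n : ℕ) :
      eLpNorm (fun x => cutoff (n + 1) x * w x) (ENNReal.ofReal (sobolevExp d)) volume
      ≤ C₀ * (eLpNorm g 2 volume + C₁ * eLpNorm w (ENNReal.ofReal q) (weightedMeasure d γ)) := by
    have hχ : ContDiff ℝ ∞ (cutoff (n + 1) : Space d → ℝ) := contDiff_cutoff _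
    have hχ' : Continuous (∇ (cutoff (n + 1) : Space d → ℝ)) :=
      continuous_gradient (hχ.of_le (by simp))
    refine (hC₀ _ _ (h.smooth_mul hχ) (hasCompactSupport_cutoff (by positivity)).mul_right).trans
      (mul_le_mul_right ?_ _)
    refine (eLpNorm_add_le (hχ.continuous.aestronglyMeasurable.smul hg)
      (hw.smul hχ'.aestronglyMeasurable) one_le_two).trans
      (add_le_add (eLpNorm_mono fun x => ?_) (hC₁ _ w (by simp) hw))
    rw [Pi.smul_apply', norm_smul]
    exact mul_le_of_le_one_left (norm_nonneg _) (norm_cutoff_le_one _ x)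
  calc eLpNorm w (ENNReal.ofReal (sobolevExp d)) volume
      ≤ liminf (fun n : ℕ => eLpNorm (fun x => cutoff (n + 1) x * w x)
        (ENNReal.ofReal (sobolevExp d)) volume) atTop :=
        Lp.eLpNorm_lim_le_liminf_eLpNorm
          (fun n => (contDiff_cutoff _).continuous.aestronglyMeasurable.mul hw) _
          (Eventually.of_forall (tendsto_cutoff_mul w))
    _ ≤ C₀ * (eLpNorm g 2 volume + C₁ * eLpNorm w (ENNReal.ofReal q) (weightedMeasure d γ)) :=
        (liminf_le_liminf (Eventually.of_forall hbound)).trans (by simp)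
    _ ≤ C₀ * (max 1 C₁ * eLpNorm g 2 volume
          + max 1 C₁ * eLpNorm w (ENNReal.ofReal q) (weightedMeasure d γ)) := by
        gcongr
        · exact le_mul_of_one_le_left (by simp) (by exact_mod_cast le_max_left 1 C₁)
        · exact_mod_cast le_max_right 1 C₁
    _ = _ := by
        push_cast
        ring

end Sobolev

section WeightEstimates

variable {d : ℕ} {γ : ℝ} {F : Type*} [NormedAddCommGroup F]

theorem weightedMeasure_absolutelyContinuous (d : ℕ) (γ : ℝ) : weightedMeasure d γ ≪ volume :=
  withDensity_absolutelyContinuous _ _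

theorem setLIntegral_weightedMeasure {s : Set (Space d)} (hs : MeasurableSet s)
    (f : Space d → ℝ≥0∞) :
    ∫⁻ x in s, f x ∂(weightedMeasure d γ) = ∫⁻ x in s, ENNReal.ofReal (‖x‖ ^ (-γ)) * f x :=
  setLIntegral_withDensity_eq_setLIntegral_mul_non_measurable _ (by fun_prop) f hs (by simp)

theorem restrict_compl_ball_weightedMeasure_le (hγ : 0 ≤ γ) {r : ℝ} (hr : 0 < r) :
    (weightedMeasure d γ).restrict (Metric.ball 0 r)ᶜ ≤ ENNReal.ofReal (r ^ (-γ)) • volume := by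
  rw [weightedMeasure, restrict_withDensity measurableSet_ball.compl,
    ← withDensity_indicator measurableSet_ball.compl, ← withDensity_const]
  refine withDensity_mono (.of_forall (indicator_le fun x hx => ?_))
  have hrx : r ≤ ‖x‖ := by simpa using hx
  exact ENNReal.ofReal_le_ofReal (Real.rpow_le_rpow_of_nonpos hr hrx (neg_nonpos.2 hγ))

theorem setLIntegral_diff_ball_weightedMeasure_le (hγ : 0 ≤ γ) {r : ℝ} (hr : 0 < r)
    {s : Set (Space d)} (hs : MeasurableSet s) (f : Space d → ℝ≥0∞) :
    ∫⁻ x in s \ Metric.ball 0 r, f x ∂(weightedMeasure d γ)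
      ≤ ENNReal.ofReal (r ^ (-γ)) * ∫⁻ x in s, f x := by
  rw [sdiff_eq, ← Measure.restrict_restrict hs, ← smul_eq_mul, ← lintegral_smul_measure,
    ← Measure.restrict_smul]
  exact lintegral_mono' (Measure.restrict_mono_measure
    (restrict_compl_ball_weightedMeasure_le hγ hr) s) le_rfl

theorem integrableOn_norm_rpow_neg [NeZero d] (hγ : γ < d) (r : ℝ) :
    IntegrableOn (fun x : Space d => ‖x‖ ^ (-γ)) (Metric.ball 0 r) := by
  rcases le_or_gt r 0 with hr | hr
  · simp [Metric.ball_eq_empty.2 hr]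
  rw [integrableOn_fun_norm_addHaar volume (f := fun y : ℝ => y ^ (-γ))]
  refine ((intervalIntegral.integrableOn_Ioo_rpow_iff hr (s := (d : ℝ) - 1 - γ)).2
    (by linarith)).congr_fun (fun y hy => ?_) measurableSet_Ioo
  simp only [finrank_euclideanSpace, Fintype.card_fin, smul_eq_mul]
  rw [← Real.rpow_natCast, ← Real.rpow_add hy.1, Nat.cast_sub (NeZero.one_le), Nat.cast_one]
  ring_nf

theorem weightedMeasure_ball_lt_top [NeZero d] (hγ : γ < d) (r : ℝ) :
    weightedMeasure d γ (Metric.ball 0 r) < ⊤ := by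
  have hint := (integrableOn_norm_rpow_neg hγ r).2
  rw [hasFiniteIntegral_iff_ofReal (.of_forall fun x => by positivity)] at hint
  rwa [weightedMeasure, withDensity_apply _ measurableSet_ball]

theorem tendsto_weightedMeasure_ball [NeZero d] (hγ : γ < d) :
    Tendsto (fun r => weightedMeasure d γ (Metric.ball 0 r)) (𝓝[>] 0) (𝓝 0) := by
  have hlim := tendsto_measure_biInter_gt (μ := weightedMeasure d γ) (a := (0 : ℝ))
    (s := fun r => Metric.ball (0 : Space d) r) (fun _ _ => measurableSet_ball.nullMeasurableSet)
    (fun _ _ _ => Metric.ball_subset_ball) ⟨1, one_pos, (weightedMeasure_ball_lt_top hγ 1).ne⟩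
  rwa [Metric.biInter_gt_ball, Metric.closedBall_zero,
    weightedMeasure_absolutelyContinuous d γ (measure_singleton 0)] at hlim

theorem setLIntegral_ball_rpow_le {u : Space d → F} (hu : AEStronglyMeasurable u) {q Q : ℝ}
    (hq : 0 ≤ q) (hqQ : q < Q) (r : ℝ) :
    ∫⁻ x in Metric.ball 0 r, ‖u x‖ₑ ^ q ∂(weightedMeasure d γ)
      ≤ (∫⁻ x, ‖u x‖ₑ ^ Q) ^ (q / Q)
        * weightedMeasure d (γ / (1 - q / Q)) (Metric.ball 0 r) ^ (1 - q / Q) := by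
  have hQ : 0 < Q := hq.trans_lt hqQ
  have hb : 0 < 1 - q / Q := sub_pos.2 ((div_lt_one hQ).2 hqQ)
  calc ∫⁻ x in Metric.ball 0 r, ‖u x‖ₑ ^ q ∂(weightedMeasure d γ)
      = ∫⁻ x in Metric.ball 0 r, (‖u x‖ₑ ^ Q) ^ (q / Q)
          * ENNReal.ofReal (‖x‖ ^ (-(γ / (1 - q / Q)))) ^ (1 - q / Q) := by
        rw [setLIntegral_weightedMeasure measurableSet_ball]
        refine lintegral_congr fun x => ?_
        rw [← ENNReal.rpow_mul, mul_div_cancel₀ _ hQ.ne',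
          ENNReal.ofReal_rpow_of_nonneg (by positivity) hb.le, ← Real.rpow_mul (norm_nonneg _),
          neg_mul, div_mul_cancel₀ _ hb.ne', mul_comm]
    _ ≤ (∫⁻ x in Metric.ball 0 r, ‖u x‖ₑ ^ Q) ^ (q / Q)
          * (∫⁻ x in Metric.ball 0 r, ENNReal.ofReal (‖x‖ ^ (-(γ / (1 - q / Q))))) ^ (1 - q / Q) :=
        ENNReal.lintegral_mul_norm_pow_le (hu.enorm.pow_const _).restrict (by fun_prop)
          (by positivity) hb.le (by ring)
    _ ≤ (∫⁻ x, ‖u x‖ₑ ^ Q) ^ (q / Q)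
          * weightedMeasure d (γ / (1 - q / Q)) (Metric.ball 0 r) ^ (1 - q / Q) := by
        rw [weightedMeasure, withDensity_apply _ measurableSet_ball]
        gcongr
        exact Measure.restrict_le_self

theorem lintegral_enorm_rpow_le_rpow_mul_rpow {X : Type*} [MeasurableSpace X] {μ : Measure X}
    {u : X → F} (hu : AEStronglyMeasurable u μ) {a q b : ℝ} (ha : 0 ≤ a) (haq : a ≤ q)
    (hqb : q < b) :
    ∫⁻ x, ‖u x‖ₑ ^ q ∂μ ≤ (∫⁻ x, ‖u x‖ₑ ^ a ∂μ) ^ (1 - (q - a) / (b - a))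
      * (∫⁻ x, ‖u x‖ₑ ^ b ∂μ) ^ ((q - a) / (b - a)) := by
  have hba : 0 < b - a := by linarith
  have ht : 0 ≤ 1 - (q - a) / (b - a) := by rw [sub_nonneg, div_le_one hba]; linarith
  have ht0 : 0 ≤ (q - a) / (b - a) := div_nonneg (by linarith) hba.le
  refine (lintegral_congr fun x => ?_).trans_le
    (ENNReal.lintegral_mul_norm_pow_le (hu.enorm.pow_const a) (hu.enorm.pow_const b) ht ht0
      (by ring))
  rw [← ENNReal.rpow_mul, ← ENNReal.rpow_mul,
    ← ENNReal.rpow_add_of_nonneg _ _ (mul_nonneg ha ht) (mul_nonneg (by linarith) ht0)]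
  congr 1
  field_simp
  ring

theorem exists_setLIntegral_ball_rpow_le [NeZero d] {q Q : ℝ} (hq : 0 ≤ q) (hqQ : q < Q)
    (hγ : γ < d * (1 - q / Q)) {B η : ℝ≥0∞} (hB : B ≠ ⊤) (hη : 0 < η) :
    ∃ r : ℝ, 0 < r ∧ ∀ u : Space d → F, AEStronglyMeasurable u → ∫⁻ x, ‖u x‖ₑ ^ Q ≤ B →
      ∫⁻ x in Metric.ball 0 r, ‖u x‖ₑ ^ q ∂(weightedMeasure d γ) ≤ η := by
  have hQ : 0 < Q := hq.trans_lt hqQ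
  have hb : 0 < 1 - q / Q := sub_pos.2 ((div_lt_one hQ).2 hqQ)
  have hlim : Tendsto (fun r => B ^ (q / Q)
      * weightedMeasure d (γ / (1 - q / Q)) (Metric.ball 0 r) ^ (1 - q / Q)) (𝓝[>] 0) (𝓝 0) := by
    have := ENNReal.Tendsto.const_mul (a := B ^ (q / Q))
      ((tendsto_weightedMeasure_ball ((div_lt_iff₀ hb).2 hγ)).ennrpow_const (1 - q / Q))
      (.inr (ENNReal.rpow_ne_top_of_nonneg (by positivity) hB))
    rwa [ENNReal.zero_rpow_of_pos hb, mul_zero] at this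
  obtain ⟨r, hr, hrη⟩ := (eventually_mem_nhdsWithin.and (hlim.eventually (ge_mem_nhds hη))).exists
  refine ⟨r, hr, fun u hu huB => (setLIntegral_ball_rpow_le hu hq hqQ r).trans (hrη.trans' ?_)⟩
  gcongr

theorem exists_setLIntegral_diff_ball_rpow_le (hγ : 0 ≤ γ) {r : ℝ} (hr : 0 < r) {a q Q : ℝ}
    (ha : 0 ≤ a) (haq : a ≤ q) (hqQ : q < Q) {B η : ℝ≥0∞} (hB : B ≠ ⊤) (hη : 0 < η) :
    ∃ δ : ℝ≥0∞, 0 < δ ∧ ∀ (s : Set (Space d)) (u : Space d → F), MeasurableSet s →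
      AEStronglyMeasurable u → ∫⁻ x in s, ‖u x‖ₑ ^ a ≤ δ → ∫⁻ x, ‖u x‖ₑ ^ Q ≤ B →
      ∫⁻ x in s \ Metric.ball 0 r, ‖u x‖ₑ ^ q ∂(weightedMeasure d γ) ≤ η := by
  have hQa : 0 < Q - a := by linarith
  set t : ℝ := (q - a) / (Q - a)
  have ht0 : 0 ≤ t := div_nonneg (by linarith) hQa.le
  have ht1 : 0 < 1 - t := by rw [sub_pos, div_lt_one hQa]; linarith
  have hlim : Tendsto (fun δ : ℝ≥0∞ => ENNReal.ofReal (r ^ (-γ)) * (δ ^ (1 - t) * B ^ t))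
      (𝓝 0) (𝓝 0) := by
    have := ENNReal.Tendsto.const_mul (a := ENNReal.ofReal (r ^ (-γ)))
      (ENNReal.Tendsto.mul_const (b := B ^ t) ((tendsto_id (x := 𝓝 0)).ennrpow_const (1 - t))
        (.inr (ENNReal.rpow_ne_top_of_nonneg ht0 hB))) (.inr ENNReal.ofReal_ne_top)
    rwa [ENNReal.zero_rpow_of_pos ht1, zero_mul, mul_zero] at this
  obtain ⟨δ, hδ, hδη⟩ := ENNReal.nhds_zero_basis_Iic.eventually_iff.1
    (hlim.eventually (ge_mem_nhds hη))
  refine ⟨δ, hδ, fun s u hs hu hua huB => ?_⟩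
  calc ∫⁻ x in s \ Metric.ball 0 r, ‖u x‖ₑ ^ q ∂(weightedMeasure d γ)
      ≤ ENNReal.ofReal (r ^ (-γ)) * ∫⁻ x in s, ‖u x‖ₑ ^ q :=
        setLIntegral_diff_ball_weightedMeasure_le hγ hr hs _
    _ ≤ ENNReal.ofReal (r ^ (-γ)) * (δ ^ (1 - t) * B ^ t) := by
        gcongr
        refine (lintegral_enorm_rpow_le_rpow_mul_rpow hu.restrict ha haq hqQ).trans ?_
        gcongr
        exact (setLIntegral_le_lintegral _ _).trans huB
    _ ≤ η := hδη (mem_Iic.2 le_rfl)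

theorem exists_setLIntegral_compl_ball_rpow_le (hγ : 0 < γ) {a q Q : ℝ} (ha : 0 ≤ a)
    (haq : a < q) (hqQ : q < Q) {A B η : ℝ≥0∞} (hA : A ≠ ⊤) (hB : B ≠ ⊤) (hη : 0 < η) :
    ∃ R : ℝ, 0 < R ∧ ∀ w : Space d → F, AEStronglyMeasurable w →
      ∫⁻ x, ‖w x‖ₑ ^ a ∂(weightedMeasure d γ) ≤ A → ∫⁻ x, ‖w x‖ₑ ^ Q ≤ B →
      ∫⁻ x in (Metric.ball 0 R)ᶜ, ‖w x‖ₑ ^ q ∂(weightedMeasure d γ) ≤ η := by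
  have hQa : 0 < Q - a := by linarith
  set t : ℝ := (q - a) / (Q - a)
  have ht0 : 0 < t := div_pos (by linarith) hQa
  have ht1 : 0 ≤ 1 - t := by rw [sub_nonneg, div_le_one hQa]; linarith
  have hlim : Tendsto (fun R : ℝ => A ^ (1 - t) * (ENNReal.ofReal (R ^ (-γ)) * B) ^ t)
      atTop (𝓝 0) := by
    have hweight : Tendsto (fun R : ℝ => ENNReal.ofReal (R ^ (-γ)) * B) atTop (𝓝 0) := by
      have := ENNReal.Tendsto.mul_const (b := B)
        (ENNReal.tendsto_ofReal (tendsto_rpow_neg_atTop hγ)) (.inr hB)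
      rwa [ENNReal.ofReal_zero, zero_mul] at this
    have := ENNReal.Tendsto.const_mul (a := A ^ (1 - t)) (hweight.ennrpow_const t)
      (.inr (ENNReal.rpow_ne_top_of_nonneg ht1 hA))
    rwa [ENNReal.zero_rpow_of_pos ht0, mul_zero] at this
  obtain ⟨R, hR, hRη⟩ := ((eventually_gt_atTop 0).and
    (hlim.eventually (ge_mem_nhds hη))).exists
  refine ⟨R, hR, fun w hw hwA hwB => ?_⟩
  have hw' : AEStronglyMeasurable w ((weightedMeasure d γ).restrict (Metric.ball 0 R)ᶜ) :=
    (hw.mono_ac (weightedMeasure_absolutelyContinuous d γ)).restrict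
  have hwQ : ∫⁻ x in (Metric.ball 0 R)ᶜ, ‖w x‖ₑ ^ Q ∂(weightedMeasure d γ)
      ≤ ENNReal.ofReal (R ^ (-γ)) * B := by
    rw [compl_eq_univ_sdiff]
    refine (setLIntegral_diff_ball_weightedMeasure_le hγ.le hR .univ _).trans ?_
    rw [setLIntegral_univ]
    gcongr
  refine (lintegral_enorm_rpow_le_rpow_mul_rpow hw' ha haq.le hqQ).trans (hRη.trans' ?_)
  gcongr
  exact (setLIntegral_le_lintegral _ _).trans hwA

end WeightEstimates

section Cells

variable {d : ℕ} {h : ℝ}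

/-- The index of the cell of the grid `h ℤ^d` that contains `x`. -/
noncomputable def cellIndex (h : ℝ) (x : Space d) : Fin d → ℤ := fun i => ⌊x i / h⌋

/-- The half-open cube of side `h` of the grid `h ℤ^d` with lowest vertex `h k`. -/
def cell (h : ℝ) (k : Fin d → ℤ) : Set (Space d) := cellIndex h ⁻¹' {k}

theorem measurable_cellIndex (h : ℝ) : Measurable (cellIndex h : Space d → Fin d → ℤ) :=
  measurable_pi_lambda _ fun i => Int.measurable_floor.comp (by fun_prop)

theorem measurableSet_cell (h : ℝ) (k : Fin d → ℤ) : MeasurableSet (cell h k) :=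
  measurable_cellIndex h (measurableSet_singleton k)

theorem volume_cell (hh : 0 < h) (k : Fin d → ℤ) : volume (cell h k) = ENNReal.ofReal h ^ d := by
  have hcube : cell h k = (WithLp.ofLp : Space d → Fin d → ℝ) ⁻¹'
      (Set.pi univ fun i => Ico (h * k i) (h * k i + h)) := by
    ext x
    simp only [cell, cellIndex, mem_preimage, mem_singleton_iff, funext_iff, Set.mem_pi, mem_univ,
      true_imp_iff, mem_Ico, Int.floor_eq_iff, le_div_iff₀ hh, div_lt_iff₀ hh]
    refine forall_congr' fun i => ?_
    rw [mul_comm, add_mul, one_mul, mul_comm (k i : ℝ)]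
  rw [hcube, (PiLp.volume_preserving_ofLp (Fin d)).measure_preimage
    (MeasurableSet.univ_pi fun i => measurableSet_Ico).nullMeasurableSet, Real.volume_pi_Ico]
  simp

theorem cell_subset_ball (hh : 0 < h) {k : Fin d → ℤ} {x : Space d} (hx : x ∈ cell h k) :
    cell h k ⊆ Metric.ball x ((d + 1) * h) := by
  intro y hy
  have hcoord (i : Fin d) : ‖(y - x) i‖ ≤ h := by
    have hfloor := Int.abs_sub_lt_one_of_floor_eq_floor
      (congrFun ((mem_preimage.1 hy).trans (mem_preimage.1 hx).symm) i)
    rw [← sub_div, abs_div, abs_of_pos hh, div_lt_one hh] at hfloor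
    exact hfloor.le
  rw [mem_ball_iff_norm]
  calc ‖y - x‖ = ‖∑ i, (y - x) i • EuclideanSpace.basisFun (Fin d) ℝ i‖ := by
        conv_lhs => rw [← (EuclideanSpace.basisFun (Fin d) ℝ).sum_repr (y - x)]
        simp
    _ ≤ ∑ _i : Fin d, h := by
        refine norm_sum_le_of_le _ fun i _ => ?_
        rw [norm_smul, OrthonormalBasis.norm_eq_one, mul_one]
        exact hcoord i
    _ < (d + 1) * h := by
        rw [Finset.sum_const, Finset.card_univ, Fintype.card_fin, nsmul_eq_mul]
        linarith

theorem exists_cell_subset_ball_zero (hh : 0 < h) (k : Fin d → ℤ) :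
    ∃ ρ : ℝ, 0 < ρ ∧ cell h k ⊆ Metric.ball (0 : Space d) ρ := by
  rcases (cell (d := d) h k).eq_empty_or_nonempty with hempty | ⟨x, hx⟩
  · exact ⟨1, one_pos, by simp [hempty]⟩
  · refine ⟨(d + 1) * h + ‖x‖, by positivity, (cell_subset_ball hh hx).trans
      (Metric.ball_subset_ball' ?_)⟩
    rw [dist_zero_right]

theorem exists_finset_cellIndex (d : ℕ) (hh : 0 < h) (R : ℝ) :
    ∃ s : Finset (Fin d → ℤ), Metric.ball (0 : Space d) R ⊆ cellIndex h ⁻¹' s := by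
  refine ⟨Fintype.piFinset fun _ => Finset.Icc ⌊-R / h⌋ ⌊R / h⌋, fun x hx => ?_⟩
  rw [mem_preimage, Finset.mem_coe, Fintype.mem_piFinset]
  intro i
  have hi : |x i| ≤ R := (PiLp.norm_apply_le x i).trans (mem_ball_zero_iff.1 hx).le
  rw [abs_le] at hi
  exact Finset.mem_Icc.2 ⟨Int.floor_le_floor (by gcongr; exact hi.1),
    Int.floor_le_floor (by gcongr; exact hi.2)⟩

theorem integrableOn_cell (hh : 0 < h) {w : Space d → ℝ} (hw : LocallyIntegrable w volume)
    (k : Fin d → ℤ) : IntegrableOn w (cell h k) := by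
  obtain ⟨ρ, -, hρ⟩ := exists_cell_subset_ball_zero (d := d) hh k
  exact (hw.integrableOn_isCompact (isCompact_closedBall 0 ρ)).mono_set
    (hρ.trans Metric.ball_subset_closedBall)

/-- The average of `w` over the grid cell that contains `x`. -/
noncomputable def cellAverage (h : ℝ) (w : Space d → ℝ) (x : Space d) : ℝ :=
  ⨍ y in cell h (cellIndex h x), w y

theorem measurable_cellAverage (h : ℝ) (w : Space d → ℝ) : Measurable (cellAverage h w) :=
  (measurable_of_countable fun k => ⨍ y in cell h k, w y).comp (measurable_cellIndex h)

/-- The ratio of the volumes of a ball of radius `(d + 1) h` and of a cell of side `h`, which does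
not depend on `h`. -/
noncomputable def ballCellRatio (d : ℕ) : ℝ≥0∞ :=
  ENNReal.ofReal ((d + 1 : ℝ) ^ d) * volume (Metric.ball (0 : Space d) 1)

theorem ballCellRatio_ne_top (d : ℕ) : ballCellRatio d ≠ ⊤ :=
  ENNReal.mul_ne_top ENNReal.ofReal_ne_top measure_ball_lt_top.ne

theorem volume_ball_eq_ballCellRatio_mul (hh : 0 < h) (x : Space d) :
    volume (Metric.ball x ((d + 1) * h)) = ballCellRatio d * ENNReal.ofReal h ^ d := by
  rw [Measure.addHaar_ball_of_pos _ _ (by positivity), finrank_euclideanSpace, Fintype.card_fin,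
    mul_pow, ENNReal.ofReal_mul (by positivity), ENNReal.ofReal_pow hh.le, ballCellRatio]
  ring

theorem setLIntegral_ball_eq_setLIntegral_ball_zero (f : Space d → ℝ≥0∞) (x : Space d) (r : ℝ) :
    ∫⁻ y in Metric.ball x r, f y = ∫⁻ z in Metric.ball 0 r, f (x + z) := by
  rw [← (measurePreserving_add_left volume x).setLIntegral_comp_preimage_emb
    (measurableEmbedding_addLeft x), preimage_add_ball, sub_self]

theorem enorm_setAverage_cell_rpow_le (hh : 0 < h) (x : Space d) (f : Space d → ℝ) {q : ℝ}
    (hq : 1 ≤ q) :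
    ‖⨍ y in cell h (cellIndex h x), f y‖ₑ ^ q
      ≤ (ENNReal.ofReal h ^ d)⁻¹ * ∫⁻ z in Metric.ball 0 ((d + 1) * h), ‖f (x + z)‖ₑ ^ q := by
  set c := cell h (cellIndex h x)
  have hvol : volume c = ENNReal.ofReal h ^ d := volume_cell hh _
  have : NeZero (volume c) := ⟨hvol ▸ pow_ne_zero _ (by simpa using hh)⟩
  have : Fact (volume c < ⊤) := ⟨hvol ▸ ENNReal.pow_lt_top ENNReal.ofReal_lt_top⟩
  calc ‖⨍ y in c, f y‖ₑ ^ q ≤ ⨍⁻ y in c, ‖f y‖ₑ ^ q ∂volume := enorm_integral_rpow_le _ f hq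
    _ = (ENNReal.ofReal h ^ d)⁻¹ * ∫⁻ y in c, ‖f y‖ₑ ^ q := by
        rw [setLAverage_eq, hvol, ENNReal.div_eq_inv_mul]
    _ ≤ (ENNReal.ofReal h ^ d)⁻¹ * ∫⁻ y in Metric.ball x ((d + 1) * h), ‖f y‖ₑ ^ q := by
        gcongr
        exact cell_subset_ball hh rfl
    _ = (ENNReal.ofReal h ^ d)⁻¹ * ∫⁻ z in Metric.ball 0 ((d + 1) * h), ‖f (x + z)‖ₑ ^ q := by
        rw [setLIntegral_ball_eq_setLIntegral_ball_zero]

theorem lintegral_setAverage_cell_rpow_le (hh : 0 < h) {f : Space d → Space d → ℝ}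
    (hf : AEStronglyMeasurable (Function.uncurry f) (volume.prod volume)) {q : ℝ} (hq : 1 ≤ q)
    {A : ℝ≥0∞}
    (hA : ∀ z ∈ Metric.ball (0 : Space d) ((d + 1) * h), ∫⁻ x, ‖f x (x + z)‖ₑ ^ q ≤ A) :
    ∫⁻ x, ‖⨍ y in cell h (cellIndex h x), f x y‖ₑ ^ q ≤ ballCellRatio d * A := by
  have hv0 : ENNReal.ofReal h ^ d ≠ 0 := pow_ne_zero _ (by simpa using hh)
  have hshear : AEStronglyMeasurable (fun z : Space d × Space d => f z.1 (z.1 + z.2))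
      (volume.prod (volume.restrict (Metric.ball 0 ((d + 1) * h)))) :=
    (hf.comp_measurePreserving (measurePreserving_prod_add volume volume)).mono_ac
      (Measure.AbsolutelyContinuous.rfl.prod Measure.absolutelyContinuous_restrict)
  calc ∫⁻ x, ‖⨍ y in cell h (cellIndex h x), f x y‖ₑ ^ q
      ≤ ∫⁻ x, (ENNReal.ofReal h ^ d)⁻¹
          * ∫⁻ z in Metric.ball (0 : Space d) ((d + 1) * h), ‖f x (x + z)‖ₑ ^ q :=
        lintegral_mono fun x => enorm_setAverage_cell_rpow_le hh x (f x) hq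
    _ = (ENNReal.ofReal h ^ d)⁻¹
          * ∫⁻ z in Metric.ball (0 : Space d) ((d + 1) * h), ∫⁻ x, ‖f x (x + z)‖ₑ ^ q := by
        rw [lintegral_const_mul' _ _ (ENNReal.inv_ne_top.2 hv0),
          lintegral_lintegral_swap (hshear.enorm.pow_const q)]
    _ ≤ (ENNReal.ofReal h ^ d)⁻¹ * ∫⁻ _ in Metric.ball (0 : Space d) ((d + 1) * h), A :=
        mul_le_mul_right (setLIntegral_mono measurable_const hA) _
    _ = (ENNReal.ofReal h ^ d)⁻¹ * ENNReal.ofReal h ^ d * (ballCellRatio d * A) := by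
        rw [setLIntegral_const, volume_ball_eq_ballCellRatio_mul hh]
        ring
    _ = ballCellRatio d * A := by
        rw [ENNReal.inv_mul_cancel hv0 (ENNReal.pow_ne_top ENNReal.ofReal_ne_top), one_mul]

theorem lintegral_cellAverage_rpow_le (hh : 0 < h) {w : Space d → ℝ}
    (hw : AEStronglyMeasurable w) {q : ℝ} (hq : 1 ≤ q) :
    ∫⁻ x, ‖cellAverage h w x‖ₑ ^ q ≤ ballCellRatio d * ∫⁻ x, ‖w x‖ₑ ^ q :=
  lintegral_setAverage_cell_rpow_le hh (f := fun _ => w) hw.comp_snd hq fun z _ =>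
    (lintegral_add_right_eq_self (fun x => ‖w x‖ₑ ^ q) z).le

theorem sub_cellAverage_eq (hh : 0 < h) {w : Space d → ℝ} (hw : LocallyIntegrable w volume)
    (x : Space d) : w x - cellAverage h w x = ⨍ y in cell h (cellIndex h x), (w x - w y) := by
  have hvol : volume (cell h (cellIndex h x)) = ENNReal.ofReal h ^ d := volume_cell hh _
  have hvol0 : volume (cell h (cellIndex h x)) ≠ 0 := hvol ▸ pow_ne_zero _ (by simpa using hh)
  have hvolt : volume (cell h (cellIndex h x)) ≠ ⊤ :=
    hvol ▸ ENNReal.pow_ne_top ENNReal.ofReal_ne_top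
  have hint : Integrable (fun _ => w x) (volume.restrict (cell h (cellIndex h x))) :=
    integrableOn_const hvolt
  rw [cellAverage, setAverage_eq _ fun y => w x - w y,
    integral_sub hint (integrableOn_cell hh hw _), smul_sub, ← setAverage_eq, ← setAverage_eq,
    setAverage_const hvol0 hvolt]

theorem HasWeakGradient.lintegral_sub_cellAverage_rpow_le (hh : 0 < h) {w : Space d → ℝ}
    {g : Space d → Space d} (hwg : HasWeakGradient w g) {q : ℝ} (hq : 1 ≤ q) :
    ∫⁻ x, ‖w x - cellAverage h w x‖ₑ ^ q
      ≤ ballCellRatio d * (ENNReal.ofReal ((d + 1) * h) ^ q * ∫⁻ x, ‖g x‖ₑ ^ q) := by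
  have hw := hwg.locInt.aestronglyMeasurable
  simp_rw [sub_cellAverage_eq hh hwg.locInt]
  refine lintegral_setAverage_cell_rpow_le hh (f := fun x y => w x - w y)
    (hw.comp_fst.sub hw.comp_snd) hq fun z hz => ?_
  calc ∫⁻ x, ‖w x - w (x + z)‖ₑ ^ q = ∫⁻ x, ‖w (x + z) - w x‖ₑ ^ q := by
        simp_rw [enorm_sub_rev]
    _ ≤ ‖z‖ₑ ^ q * ∫⁻ x, ‖g x‖ₑ ^ q := hwg.lintegral_enorm_translate_sub_rpow_le z hq
    _ ≤ ENNReal.ofReal ((d + 1) * h) ^ q * ∫⁻ x, ‖g x‖ₑ ^ q := by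
        rw [← ofReal_norm]
        gcongr
        exact (mem_ball_zero_iff.1 hz).le

end Cells

section GridApproximation

theorem eLpNorm_rpow_eq_lintegral {X F : Type*} [MeasurableSpace X] [NormedAddCommGroup F]
    {μ : Measure X} {q : ℝ} (hq : 0 < q) (f : X → F) :
    eLpNorm f (ENNReal.ofReal q) μ ^ q = ∫⁻ x, ‖f x‖ₑ ^ q ∂μ := by
  rw [eLpNorm_eq_lintegral_rpow_enorm_toReal (by simpa using hq) (by simp),
    ENNReal.toReal_ofReal hq.le, ← ENNReal.rpow_mul, one_div, inv_mul_cancel₀ hq.ne',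
    ENNReal.rpow_one]

variable {d : ℕ}

theorem lintegral_sub_indicator_cellAverage_rpow_le {h : ℝ} (hh : 0 < h) {w : Space d → ℝ}
    (hw : AEStronglyMeasurable w) {q : ℝ} (hq : 1 ≤ q) (S : Set (Space d)) :
    ∫⁻ x, ‖w x - S.indicator (cellAverage h w) x‖ₑ ^ q
      ≤ 2 ^ (q - 1) * ((1 + ballCellRatio d) * ∫⁻ x, ‖w x‖ₑ ^ q) := by
  have hpointwise : ∀ x, ‖w x - S.indicator (cellAverage h w) x‖ₑ ^ q
      ≤ 2 ^ (q - 1) * (‖w x‖ₑ ^ q + ‖cellAverage h w x‖ₑ ^ q) := fun x => by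
    refine (ENNReal.rpow_le_rpow (enorm_sub_le.trans ?_) (by positivity)).trans
      (ENNReal.rpow_add_le_mul_rpow_add_rpow _ _ hq)
    gcongr
    exact enorm_indicator_le_enorm_self _ _
  calc ∫⁻ x, ‖w x - S.indicator (cellAverage h w) x‖ₑ ^ q
      ≤ ∫⁻ x, 2 ^ (q - 1) * (‖w x‖ₑ ^ q + ‖cellAverage h w x‖ₑ ^ q) := lintegral_mono hpointwise
    _ = 2 ^ (q - 1) * ((∫⁻ x, ‖w x‖ₑ ^ q) + ∫⁻ x, ‖cellAverage h w x‖ₑ ^ q) := by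
      rw [lintegral_const_mul' _ _ (ENNReal.rpow_ne_top_of_nonneg (by linarith) (by simp)),
        lintegral_add_left' (hw.enorm.pow_const _)]
    _ ≤ _ := by
      rw [add_mul, one_mul]
      gcongr
      exact lintegral_cellAverage_rpow_le hh hw hq

theorem HasWeakGradient.setLIntegral_sub_indicator_cellAverage_sq_le {h : ℝ} (hh : 0 < h)
    {w : Space d → ℝ} {g : Space d → Space d} (hwg : HasWeakGradient w g) {S : Set (Space d)}
    (hS : MeasurableSet S) (hg : ∫⁻ x, ‖g x‖ₑ ^ (2 : ℝ) ≤ 1) :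
    ∫⁻ x in S, ‖w x - S.indicator (cellAverage h w) x‖ₑ ^ (2 : ℝ)
      ≤ ballCellRatio d * ENNReal.ofReal ((d + 1) * h) ^ (2 : ℝ) := by
  calc ∫⁻ x in S, ‖w x - S.indicator (cellAverage h w) x‖ₑ ^ (2 : ℝ)
      = ∫⁻ x in S, ‖w x - cellAverage h w x‖ₑ ^ (2 : ℝ) :=
        setLIntegral_congr_fun hS fun x hx => by simp only [indicator_of_mem hx]
    _ ≤ ∫⁻ x, ‖w x - cellAverage h w x‖ₑ ^ (2 : ℝ) := setLIntegral_le_lintegral _ _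
    _ ≤ ballCellRatio d * (ENNReal.ofReal ((d + 1) * h) ^ (2 : ℝ) * ∫⁻ x, ‖g x‖ₑ ^ (2 : ℝ)) :=
        hwg.lintegral_sub_cellAverage_rpow_le hh (by norm_num)
    _ ≤ ballCellRatio d * (ENNReal.ofReal ((d + 1) * h) ^ (2 : ℝ) * 1) := by gcongr
    _ = _ := by rw [mul_one]

theorem exists_pos_ballCellRatio_mul_le (d : ℕ) {δ : ℝ≥0∞} (hδ : 0 < δ) :
    ∃ h : ℝ, 0 < h ∧ ballCellRatio d * ENNReal.ofReal ((d + 1) * h) ^ (2 : ℝ) ≤ δ := by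
  have hcont : Continuous fun h : ℝ => ENNReal.ofReal ((d + 1) * h) ^ (2 : ℝ) :=
    ENNReal.continuous_rpow_const.comp (ENNReal.continuous_ofReal.comp (by fun_prop))
  have hlim : Tendsto (fun h : ℝ => ballCellRatio d * ENNReal.ofReal ((d + 1) * h) ^ (2 : ℝ))
      (𝓝[>] 0) (𝓝 0) := by
    have := ENNReal.Tendsto.const_mul (a := ballCellRatio d)
      ((hcont.tendsto 0).mono_left (nhdsWithin_le_nhds (s := Ioi 0)))
      (Or.inr (ballCellRatio_ne_top d))
    simpa using this
  exact (eventually_mem_nhdsWithin.and (hlim.eventually (ge_mem_nhds hδ))).exists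

theorem lintegral_le_setLIntegral_add_diff_add {X : Type*} [MeasurableSpace X] {μ : Measure X}
    {f g : X → ℝ≥0∞} {S N E : Set X} (hS : MeasurableSet S) (hE : Sᶜ ⊆ E)
    (hfg : ∀ x ∉ S, f x = g x) :
    ∫⁻ x, f x ∂μ
      ≤ ∫⁻ x in N, f x ∂μ + ∫⁻ x in S \ N, f x ∂μ + ∫⁻ x in E, g x ∂μ := by
  calc ∫⁻ x, f x ∂μ = ∫⁻ x in S, f x ∂μ + ∫⁻ x in Sᶜ, f x ∂μ :=
        (lintegral_add_compl f hS).symm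
    _ ≤ ∫⁻ x in N ∪ S \ N, f x ∂μ + ∫⁻ x in Sᶜ, g x ∂μ :=
        add_le_add (lintegral_mono_set (by simp))
          (setLIntegral_congr_fun hS.compl hfg).le
    _ ≤ _ := add_le_add (lintegral_union_le _ _ _) (lintegral_mono_set hE)

theorem two_mul_lt_sobolevExp [Fact (3 ≤ d)] {p γ : ℝ} (hγ : 0 < γ) (hp : p * (d - 2) < d - γ) :
    2 * p < sobolevExp d := by
  have hd := three_le_natCast d
  rw [sobolevExp, lt_div_iff₀ (by linarith)]
  linarith

theorem lt_mul_one_sub_div_sobolevExp [Fact (3 ≤ d)] {p γ : ℝ} (hp : p * (d - 2) < d - γ) :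
    γ < d * (1 - 2 * p / sobolevExp d) := by
  have hd := three_le_natCast d
  have : (d : ℝ) * (1 - 2 * p / sobolevExp d) = d - p * (d - 2) := by
    have : (d : ℝ) - 2 ≠ 0 := by linarith
    rw [sobolevExp]
    field_simp
  linarith

theorem HasWeakGradient.exists_cellAverage_approx [Fact (3 ≤ d)] {p γ : ℝ} (hp1 : 1 < p)
    (hγ : 0 < γ) (hp : p * (d - 2) < d - γ) {B η : ℝ≥0∞} (hB : B ≠ ⊤) (hη : 0 < η) :
    ∃ (h : ℝ) (s : Finset (Fin d → ℤ)), 0 < h ∧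
      ∀ (w : Space d → ℝ) (g : Space d → Space d), HasWeakGradient w g →
        ∫⁻ x, ‖w x‖ₑ ^ sobolevExp d ≤ B → ∫⁻ x, ‖w x‖ₑ ^ (p + 1) ∂(weightedMeasure d γ) ≤ 1 →
        ∫⁻ x, ‖g x‖ₑ ^ (2 : ℝ) ≤ 1 →
        ∫⁻ x, ‖w x - (cellIndex h ⁻¹' s).indicator (cellAverage h w) x‖ₑ ^ (2 * p)
          ∂(weightedMeasure d γ) ≤ η := by
  have hpQ := two_mul_lt_sobolevExp hγ hp
  have hB' : 2 ^ (sobolevExp d - 1) * ((1 + ballCellRatio d) * B) ≠ ⊤ :=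
    ENNReal.mul_ne_top (ENNReal.rpow_ne_top_of_nonneg (by linarith) (by simp))
      (ENNReal.mul_ne_top (by simp [ballCellRatio_ne_top]) hB)
  have hη3 : 0 < η / 3 := ENNReal.div_pos hη.ne' (by simp)
  obtain ⟨r, hr, hnear⟩ := exists_setLIntegral_ball_rpow_le (F := ℝ) (by linarith) hpQ
    (lt_mul_one_sub_div_sobolevExp hp) hB' hη3
  obtain ⟨δ, hδ, hmiddle⟩ := exists_setLIntegral_diff_ball_rpow_le (F := ℝ) (a := 2) hγ.le hr
    (by norm_num) (by linarith) hpQ hB' hη3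
  obtain ⟨R, -, hfar⟩ := exists_setLIntegral_compl_ball_rpow_le (F := ℝ) (a := p + 1) hγ
    (by linarith) (by linarith) hpQ ENNReal.one_ne_top hB hη3
  obtain ⟨h, hh, hhδ⟩ := exists_pos_ballCellRatio_mul_le d hδ
  obtain ⟨s, hs⟩ := exists_finset_cellIndex d hh R
  refine ⟨h, s, hh, fun w g hwg hwB hwp hg => ?_⟩
  set S : Set (Space d) := cellIndex h ⁻¹' s
  set u : Space d → ℝ := fun x => w x - S.indicator (cellAverage h w) x with hu
  have hSm : MeasurableSet S := measurable_cellIndex h s.measurableSet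
  have hwm : AEStronglyMeasurable w := hwg.locInt.aestronglyMeasurable
  have hum : AEStronglyMeasurable u :=
    hwm.sub ((measurable_cellAverage h w).indicator hSm).aestronglyMeasurable
  have huB : ∫⁻ x, ‖u x‖ₑ ^ sobolevExp d ≤ 2 ^ (sobolevExp d - 1) * ((1 + ballCellRatio d) * B) :=
    (lintegral_sub_indicator_cellAverage_rpow_le hh hwm (by linarith) S).trans (by gcongr)
  have huδ : ∫⁻ x in S, ‖u x‖ₑ ^ (2 : ℝ) ≤ δ :=
    (hwg.setLIntegral_sub_indicator_cellAverage_sq_le hh hSm hg).trans hhδ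
  calc ∫⁻ x, ‖u x‖ₑ ^ (2 * p) ∂(weightedMeasure d γ)
      ≤ _ := lintegral_le_setLIntegral_add_diff_add hSm (compl_subset_compl.2 hs)
        fun x hx => by simp only [hu, indicator_of_notMem hx, sub_zero]
    _ ≤ η / 3 + η / 3 + η / 3 :=
      add_le_add (add_le_add (hnear u hum huB) (hmiddle S u hSm hum huδ huB)) (hfar w hwm hwp hwB)
    _ = η := ENNReal.add_thirds η

end GridApproximation

section WeightedLp

variable {d : ℕ} [NeZero d] {γ : ℝ}

theorem exists_setLIntegral_ball_enorm_le (hγ : 0 ≤ γ) {ρ : ℝ} (hρ : 0 < ρ) {q : ℝ} (hq : 1 ≤ q) :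
    ∃ C : ℝ≥0, ∀ w : Space d → ℝ, AEStronglyMeasurable w →
      ∫⁻ x in Metric.ball 0 ρ, ‖w x‖ₑ ≤ C * eLpNorm w (ENNReal.ofReal q) (weightedMeasure d γ) := by
  have hexp : 0 ≤ 1 / 1 - 1 / q := sub_nonneg.2 (one_div_le_one_div_of_le one_pos hq)
  obtain ⟨C, hC⟩ : ∃ C : ℝ≥0, (C : ℝ≥0∞) = ENNReal.ofReal (ρ ^ (γ / q + d * (1 / 1 - 1 / q)))
      * volume (Metric.ball (0 : Space d) 1) ^ (1 / 1 - 1 / q) :=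
    ⟨_, ENNReal.coe_toNNReal (ENNReal.mul_ne_top ENNReal.ofReal_ne_top
      (ENNReal.rpow_ne_top_of_nonneg hexp measure_ball_lt_top.ne))⟩
  refine ⟨C, fun w hw => ?_⟩
  rw [hC]
  simpa [eLpNorm_one_eq_lintegral_enorm] using
    eLpNorm_restrict_ball_le_of_exponent_le hγ hρ one_pos hq hw

theorem locallyIntegrable_of_memLp_weightedMeasure (hγ : 0 ≤ γ) {q : ℝ} (hq : 1 ≤ q)
    {w : Space d → ℝ} (hwm : AEStronglyMeasurable w)
    (hw : MemLp w (ENNReal.ofReal q) (weightedMeasure d γ)) : LocallyIntegrable w := fun x => by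
  obtain ⟨C, hC⟩ := exists_setLIntegral_ball_enorm_le (d := d) hγ
    (by positivity : 0 < ‖x‖ + 1) hq
  exact ⟨Metric.ball 0 (‖x‖ + 1), Metric.isOpen_ball.mem_nhds (by simp), hwm.restrict,
    (hC w hwm).trans_lt (ENNReal.mul_lt_top (by simp) hw.2)⟩

end WeightedLp

section WeightedFunctional

theorem enorm_integral_mul_le_of_forall_le {X : Type*} [MeasurableSpace X] {μ : Measure X}
    {f ψ : X → ℝ} {K : ℝ} (hK : ∀ x, ‖ψ x‖ ≤ K) :
    ‖∫ x, f x * ψ x ∂μ‖ₑ ≤ ENNReal.ofReal K * ∫⁻ x, ‖f x‖ₑ ∂μ := by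
  rw [← lintegral_const_mul' _ _ ENNReal.ofReal_ne_top]
  refine (enorm_integral_le_lintegral_enorm _).trans (lintegral_mono fun x => ?_)
  rw [enorm_mul, mul_comm]
  gcongr
  exact (ofReal_norm _).symm.trans_le (ENNReal.ofReal_le_ofReal (hK x))

theorem aestronglyMeasurable_coeFn {d : ℕ} {γ q : ℝ} (f : WLp d γ q) :
    AEStronglyMeasurable f :=
  (Lp.stronglyMeasurable f).aestronglyMeasurable

variable {d : ℕ} [Fact (3 ≤ d)] {γ q : ℝ} [Fact (1 ≤ ENNReal.ofReal q)]

theorem exists_continuousLinearMap_integral_mul (hγ : 0 ≤ γ) {ρ K : ℝ} (hρ : 0 < ρ)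
    {ψ : Space d → ℝ} (hψ : AEStronglyMeasurable ψ) (hK : ∀ x, ‖ψ x‖ ≤ K)
    (hsupp : ∀ x ∉ Metric.ball 0 ρ, ψ x = 0) :
    ∃ l : WLp d γ q →L[ℝ] ℝ, ∀ f, l f = ∫ x, f x * ψ x := by
  have hq : 1 ≤ q := ENNReal.one_le_ofReal.1 Fact.out
  obtain ⟨C, hC⟩ := exists_setLIntegral_ball_enorm_le (d := d) hγ hρ hq
  have hint : ∀ f : WLp d γ q, Integrable fun x => f x * ψ x := fun f => by
    rw [← integrableOn_iff_integrable_of_support_subset (s := Metric.ball 0 ρ)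
      fun x hx => by_contra fun hx' => hx (by simp [hsupp x hx'])]
    refine Integrable.mul_bdd (c := K) ?_ hψ.restrict (.of_forall hK)
    exact ⟨(aestronglyMeasurable_coeFn f).restrict,
      (hC f (aestronglyMeasurable_coeFn f)).trans_lt
        (ENNReal.mul_lt_top (by simp) (Lp.memLp f).2)⟩
  have hbound : ∀ f : WLp d γ q, ‖∫ x, f x * ψ x‖ ≤ K * C * ‖f‖ := fun f => by
    have hK0 : 0 ≤ K := (norm_nonneg _).trans (hK 0)
    rw [← setIntegral_eq_integral_of_forall_compl_eq_zero (s := Metric.ball 0 ρ)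
      fun x hx => by simp [hsupp x hx], ← ENNReal.ofReal_le_ofReal_iff (by positivity), ofReal_norm]
    calc ‖∫ x in Metric.ball 0 ρ, f x * ψ x‖ₑ
        ≤ ENNReal.ofReal K * ∫⁻ x in Metric.ball 0 ρ, ‖f x‖ₑ :=
          enorm_integral_mul_le_of_forall_le hK
      _ ≤ ENNReal.ofReal K * (C * ‖f‖ₑ) := by
          rw [Lp.enorm_def]
          gcongr
          exact hC f (aestronglyMeasurable_coeFn f)
      _ = ENNReal.ofReal (K * C * ‖f‖) := by
          rw [ENNReal.ofReal_mul (by positivity), ENNReal.ofReal_mul hK0, ofReal_norm,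
            ENNReal.ofReal_coe_nnreal, mul_assoc]
  let l : WLp d γ q →ₗ[ℝ] ℝ :=
    { toFun := fun f => ∫ x, f x * ψ x
      map_add' := fun f g => by
        rw [← integral_add (hint f) (hint g)]
        refine integral_congr_ae ?_
        filter_upwards [(volume_absolutelyContinuous d γ).ae_le (Lp.coeFn_add f g)] with x hx
        rw [hx, Pi.add_apply, add_mul]
      map_smul' := fun c f => by
        rw [RingHom.id_apply, smul_eq_mul, ← integral_const_mul]
        refine integral_congr_ae ?_
        filter_upwards [(volume_absolutelyContinuous d γ).ae_le (Lp.coeFn_smul c f)] with x hx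
        rw [hx, Pi.smul_apply, smul_eq_mul, mul_assoc] }
  exact ⟨l.mkContinuous (K * C) hbound, fun f => rfl⟩

theorem exists_continuousLinearMap_setAverage_cell (hγ : 0 ≤ γ) {h : ℝ} (hh : 0 < h)
    (k : Fin d → ℤ) : ∃ l : WLp d γ q →L[ℝ] ℝ, ∀ f, l f = ⨍ x in cell h k, f x := by
  obtain ⟨ρ, hρ, hsub⟩ := exists_cell_subset_ball_zero hh k
  obtain ⟨l, hl⟩ := exists_continuousLinearMap_integral_mul (q := q) (K := 1) hγ hρ
    (ψ := (cell h k).indicator 1)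
    (stronglyMeasurable_one.indicator (measurableSet_cell h k)).aestronglyMeasurable
    (fun x => (norm_indicator_le_norm_self _ _).trans (by simp))
    (fun x hx => indicator_of_notMem (fun hxk => hx (hsub hxk)) _)
  refine ⟨(volume.real (cell h k))⁻¹ • l, fun f => ?_⟩
  rw [smul_apply, hl, setAverage_eq,
    ← integral_indicator (measurableSet_cell h k)]
  simp_rw [← indicator_mul_right, Pi.one_apply, mul_one]

theorem weightedMeasure_cell_ne_top (hγ : γ < d) {h : ℝ} (hh : 0 < h) (k : Fin d → ℤ) :
    weightedMeasure d γ (cell h k) ≠ ⊤ :=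
  let ⟨ρ, _, hsub⟩ := exists_cell_subset_ball_zero hh k
  ((measure_mono hsub).trans_lt (weightedMeasure_ball_lt_top hγ ρ)).ne

theorem exists_isCompactOperator_cellAverage (hγ0 : 0 ≤ γ) (hγ : γ < d) {h : ℝ} (hh : 0 < h)
    (s : Finset (Fin d → ℤ)) (r : ℝ) [Fact (1 ≤ ENNReal.ofReal r)] :
    ∃ T : WLp d γ q →L[ℝ] WLp d γ r, IsCompactOperator T ∧
      ∀ f, T f =ᵐ[weightedMeasure d γ] (cellIndex h ⁻¹' s).indicator (cellAverage h f) := by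
  classical
  induction s using Finset.induction_on with
  | empty =>
    refine ⟨0, isCompactOperator_zero, fun f => ?_⟩
    filter_upwards [Lp.coeFn_zero ℝ (ENNReal.ofReal r) (weightedMeasure d γ)] with x hx
    simpa using hx
  | insert k s hk ih =>
    obtain ⟨T, hT, hTf⟩ := ih
    obtain ⟨l, hl⟩ := exists_continuousLinearMap_setAverage_cell (q := q) hγ0 hh k
    have hcell := weightedMeasure_cell_ne_top hγ hh k
    let e : WLp d γ r := indicatorConstLp _ (measurableSet_cell h k) hcell (1 : ℝ)
    have hspan : IsCompactOperator (ContinuousLinearMap.toSpanSingleton ℝ e) :=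
      isCompactOperator_of_locallyCompactSpace_rng _
    refine ⟨l.smulRight e + T, (hspan.comp_clm l).add hT, fun f => ?_⟩
    change ⇑(l f • e + T f) =ᵐ[weightedMeasure d γ] _
    filter_upwards [Lp.coeFn_add (l f • e) (T f), Lp.coeFn_smul (l f) e, hTf f,
      indicatorConstLp_coeFn (p := ENNReal.ofReal r) (hs := measurableSet_cell h k)
        (hμs := hcell) (c := (1 : ℝ))] with x hadd hsmul hTx he
    rw [hadd, Pi.add_apply, hsmul, hTx, Pi.smul_apply, he, hl]
    by_cases hx : cellIndex h x = k
    · have hxk : x ∈ cell h k := hx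
      simp [hx, hk, hxk, cellAverage]
    · have hxk : x ∉ cell h k := hx
      simp [indicator, hx, hxk]

end WeightedFunctional

theorem isCompactOperator_of_forall_exists_approx {E F : Type*}
    [NormedAddCommGroup E] [NormedSpace ℝ E] [NormedAddCommGroup F] [NormedSpace ℝ F]
    [CompleteSpace F] (f : E →ₗ[ℝ] F)
    (h : ∀ ε > 0, ∃ T : E →L[ℝ] F, IsCompactOperator T ∧ ∀ x, ‖x‖ ≤ 1 → ‖f x - T x‖ ≤ ε) :
    IsCompactOperator f := by
  refine (isCompactOperator_iff_isCompact_closure_image_closedBall f one_pos).2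
    (TotallyBounded.isCompact_of_isClosed ?_ isClosed_closure)
  refine TotallyBounded.closure (Metric.totallyBounded_iff.2 fun ε hε => ?_)
  obtain ⟨T, hT, hfT⟩ := h (ε / 2) (half_pos hε)
  obtain ⟨t, ht, hcover⟩ := Metric.totallyBounded_iff.1
    (hT.isCompact_closure_image_closedBall (f := T.toLinearMap) 1).totallyBounded (ε / 2)
      (half_pos hε)
  refine ⟨t, ht, ?_⟩
  rintro _ ⟨x, hx, rfl⟩
  obtain ⟨y, hyt, hxy⟩ := mem_iUnion₂.1 (hcover (subset_closure (mem_image_of_mem T hx)))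
  refine mem_iUnion₂.2 ⟨y, hyt, ?_⟩
  calc dist (f x) y ≤ dist (f x) (T x) + dist (T x) y := dist_triangle _ _ _
    _ < ε / 2 + ε / 2 := add_lt_add_of_le_of_lt
        ((dist_eq_norm _ _).trans_le (hfT x (by simpa using hx))) hxy
    _ = ε := add_halves ε

section Embedding

variable {d : ℕ} [Fact (3 ≤ d)] {p γ : ℝ} [Fact (1 < p)]

theorem hasWeakGradient_fn (w : HSpace d p γ) : HasWeakGradient (fn w) (grad w) := w.2

theorem norm_HSpace_eq_add (w : HSpace d p γ) : ‖w‖ = ‖w.1.fst‖ + ‖w.1.snd‖ :=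
  WithLp.prod_norm_eq_of_L1 w.1

theorem eLpNorm_fn_le (w : HSpace d p γ) :
    eLpNorm (fn w) (ENNReal.ofReal (p + 1)) (weightedMeasure d γ) ≤ ‖w‖ₑ := by
  rw [fn, ← Lp.enorm_def, enorm_le_iff_norm_le, norm_HSpace_eq_add w]
  exact le_add_of_nonneg_right (norm_nonneg _)

theorem eLpNorm_grad_le (w : HSpace d p γ) : eLpNorm (grad w) 2 volume ≤ ‖w‖ₑ := by
  rw [grad, ← Lp.enorm_def, enorm_le_iff_norm_le, norm_HSpace_eq_add w]
  exact le_add_of_nonneg_left (norm_nonneg _)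

theorem fn_add (v w : HSpace d p γ) : fn (v + w) =ᵐ[weightedMeasure d γ] fn v + fn w :=
  Lp.coeFn_add v.1.fst w.1.fst

theorem fn_smul (c : ℝ) (w : HSpace d p γ) : fn (c • w) =ᵐ[weightedMeasure d γ] c • fn w :=
  Lp.coeFn_smul c w.1.fst

theorem exists_lintegral_rpow_sobolevExp_le (hγ : 0 < γ) (hp : p * (d - 2) < d - γ) :
    ∃ B : ℝ≥0∞, B ≠ ⊤ ∧ ∀ w : HSpace d p γ, ‖w‖ ≤ 1 → ∫⁻ x, ‖fn w x‖ₑ ^ sobolevExp d ≤ B := by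
  have hp1 : 1 < p := Fact.out
  have hd := three_le_natCast d
  have hQ : 0 < sobolevExp d := by linarith [two_mul_lt_sobolevExp hγ hp]
  obtain ⟨C, hC⟩ := HasWeakGradient.exists_eLpNorm_sobolevExp_le (d := d) hγ.le (q := p + 1)
    (by linarith) (by nlinarith)
  refine ⟨(C * (1 + 1)) ^ sobolevExp d, by finiteness, fun w hw => ?_⟩
  have hw : ‖w‖ₑ ≤ 1 := by rwa [← ofReal_norm, ENNReal.ofReal_le_one]
  rw [← eLpNorm_rpow_eq_lintegral hQ]
  gcongr
  refine (hC _ _ (hasWeakGradient_fn w)).trans ?_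
  gcongr
  · exact (eLpNorm_fn_le w).trans hw
  · exact (eLpNorm_grad_le w).trans hw

theorem exists_isCompactOperator_approx (hγ : 0 < γ) (hp : p * (d - 2) < d - γ) {ε : ℝ≥0∞}
    (hε : 0 < ε) :
    ∃ T : HSpace d p γ →L[ℝ] WLp d γ (2 * p), IsCompactOperator T ∧ ∀ w : HSpace d p γ, ‖w‖ ≤ 1 →
      eLpNorm (fn w - ⇑(T w)) (ENNReal.ofReal (2 * p)) (weightedMeasure d γ) ≤ ε := by
  have hp1 : 1 < p := Fact.out
  have hγd : γ < d := by nlinarith [three_le_natCast d]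
  obtain ⟨B, hB, hwB⟩ := exists_lintegral_rpow_sobolevExp_le (p := p) hγ hp
  obtain ⟨h, s, hh, happrox⟩ := HasWeakGradient.exists_cellAverage_approx hp1 hγ hp hB
    (ENNReal.rpow_pos_of_nonneg (p := 2 * p) hε (by linarith))
  obtain ⟨T, hT, hTf⟩ :=
    exists_isCompactOperator_cellAverage (q := p + 1) hγ.le hγd hh s (2 * p)
  let fnL : HSpace d p γ →L[ℝ] WLp d γ (p + 1) :=
    (WithLp.fstL 1 ℝ _ _).comp (HSpace d p γ).subtypeL
  refine ⟨T.comp fnL, hT.comp_clm fnL, fun w hw => ?_⟩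
  have hw1 : ‖w‖ₑ ≤ 1 := by rwa [← ofReal_norm, ENNReal.ofReal_le_one]
  have hTw : T.comp fnL w =ᵐ[weightedMeasure d γ] _ := hTf (fnL w)
  rw [eLpNorm_congr_ae (EventuallyEq.rfl.sub hTw),
    ← ENNReal.rpow_le_rpow_iff (by linarith : 0 < 2 * p), eLpNorm_rpow_eq_lintegral (by linarith)]
  refine happrox (fn w) (grad w) (hasWeakGradient_fn w) (hwB w hw) ?_ ?_
  · rw [← eLpNorm_rpow_eq_lintegral (by linarith)]
    exact ENNReal.rpow_le_one ((eLpNorm_fn_le w).trans hw1) (by linarith)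
  · rw [← eLpNorm_rpow_eq_lintegral two_pos, ENNReal.ofReal_ofNat]
    exact ENNReal.rpow_le_one ((eLpNorm_grad_le w).trans hw1) (by norm_num)

theorem memLp_fn (hγ : 0 < γ) (hp : p * (d - 2) < d - γ) (w : HSpace d p γ) :
    MemLp (fn w) (ENNReal.ofReal (2 * p)) (weightedMeasure d γ) := by
  obtain ⟨T, -, hT⟩ := exists_isCompactOperator_approx (p := p) hγ hp one_pos
  have hunit : ∀ v : HSpace d p γ, ‖v‖ ≤ 1 →
      MemLp (fn v) (ENNReal.ofReal (2 * p)) (weightedMeasure d γ) := fun v hv => by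
    have hsub : MemLp (fn v - ⇑(T v)) (ENNReal.ofReal (2 * p)) (weightedMeasure d γ) :=
      ⟨(Lp.aestronglyMeasurable _).sub (Lp.aestronglyMeasurable _),
        (hT v hv).trans_lt ENNReal.one_lt_top⟩
    simpa using hsub.add (Lp.memLp (T v))
  have hc : 0 < ‖w‖ + 1 := by positivity
  have hscaled := hunit ((‖w‖ + 1)⁻¹ • w) (by
    rw [norm_smul, norm_inv, Real.norm_of_nonneg hc.le, inv_mul_le_one₀ hc]
    linarith)
  refine (hscaled.const_smul (‖w‖ + 1)).ae_eq ?_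
  filter_upwards [fn_smul (‖w‖ + 1)⁻¹ w] with x hx
  rw [Pi.smul_apply, hx, Pi.smul_apply, smul_inv_smul₀ hc.ne']

/-- The inclusion `w ↦ w` of `H_{p,γ}(ℝ^d)` into `L^{2p}_γ(ℝ^d)` as a linear map. -/
noncomputable def inclusion (hγ : 0 < γ) (hp : p * (d - 2) < d - γ) :
    HSpace d p γ →ₗ[ℝ] WLp d γ (2 * p) where
  toFun w := (memLp_fn hγ hp w).toLp (fn w)
  map_add' v w := by
    rw [← MemLp.toLp_add]
    exact MemLp.toLp_congr _ _ (fn_add v w)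
  map_smul' c w := by
    rw [RingHom.id_apply, ← MemLp.toLp_const_smul]
    exact MemLp.toLp_congr _ _ (fn_smul c w)

theorem isCompactOperator_inclusion (hγ : 0 < γ) (hp : p * (d - 2) < d - γ) :
    IsCompactOperator (inclusion hγ hp : HSpace d p γ →ₗ[ℝ] WLp d γ (2 * p)) := by
  refine isCompactOperator_of_forall_exists_approx _ fun ε hε => ?_
  obtain ⟨T, hT, hwT⟩ :=
    exists_isCompactOperator_approx (p := p) hγ hp (ENNReal.ofReal_pos.2 hε)
  refine ⟨T, hT, fun w hw => ?_⟩
  rw [Lp.norm_def]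
  refine ENNReal.toReal_le_of_le_ofReal hε.le ((eLpNorm_congr_ae ?_).trans_le (hwT w hw))
  exact (Lp.coeFn_sub _ _).trans ((memLp_fn hγ hp w).coeFn_toLp.sub EventuallyEq.rfl)

/-- The inclusion of `H_{p,γ}(ℝ^d)` into `L^{2p}_γ(ℝ^d)` as a continuous linear map. -/
noncomputable def embedding (hγ : 0 < γ) (hp : p * (d - 2) < d - γ) :
    HSpace d p γ →L[ℝ] WLp d γ (2 * p) :=
  ⟨inclusion hγ hp, (isCompactOperator_inclusion hγ hp).continuous⟩

theorem isCompactOperator_embedding (hγ : 0 < γ) (hp : p * (d - 2) < d - γ) :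
    IsCompactOperator (embedding hγ hp : HSpace d p γ →L[ℝ] WLp d γ (2 * p)) :=
  isCompactOperator_inclusion hγ hp

theorem coeFn_embedding (hγ : 0 < γ) (hp : p * (d - 2) < d - γ) (w : HSpace d p γ) :
    embedding hγ hp w =ᵐ[weightedMeasure d γ] fn w :=
  (memLp_fn hγ hp w).coeFn_toLp

theorem HasWeakGradient.ae_eq_zero {d : ℕ} {g : Space d → Space d}
    {w : Space d → ℝ} (h : HasWeakGradient w g) (hw : w =ᵐ[volume] 0) : g =ᵐ[volume] 0 := by
  have hinner : ∀ v : Space d, ∀ᵐ x, inner ℝ (g x) v = 0 := fun v => by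
    refine ae_eq_zero_of_integral_contDiff_smul_eq_zero (fun x => ?_) fun φ hφ hφc => ?_
    · obtain ⟨s, hs, hgs⟩ := h.locInt_grad x
      exact ⟨s, hs, hgs.inner_const v⟩
    · have hleft : ∫ x, w x * fderiv ℝ φ x v = 0 :=
        integral_eq_zero_of_ae (by filter_upwards [hw] with x hx; simp [hx])
      simpa [hleft, mul_comm, eq_comm] using h.integral_eq φ hφ hφc v
  have hcoord : ∀ᵐ x, ∀ i : Fin d, inner ℝ (g x) (EuclideanSpace.single i (1 : ℝ)) = 0 :=
    ae_all_iff.2 fun i => hinner _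
  filter_upwards [hcoord] with x hx
  ext i
  simpa [EuclideanSpace.inner_single_right] using hx i

theorem eq_zero_of_fn_ae_eq_zero {w : HSpace d p γ} (h : fn w =ᵐ[volume] 0) : w = 0 := by
  have hfst : w.1.fst = 0 :=
    Lp.eq_zero_iff_ae_eq_zero.2 ((weightedMeasure_absolutelyContinuous d γ).ae_le h)
  have hsnd : w.1.snd = 0 := Lp.eq_zero_iff_ae_eq_zero.2 ((hasWeakGradient_fn w).ae_eq_zero h)
  rw [← norm_eq_zero, norm_HSpace_eq_add w, hfst, hsnd, norm_zero, norm_zero, add_zero]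

theorem embedding_injective (hγ : 0 < γ) (hp : p * (d - 2) < d - γ) :
    Function.Injective (embedding hγ hp : HSpace d p γ →L[ℝ] WLp d γ (2 * p)) := by
  refine (injective_iff_map_eq_zero _).2 fun w hw => eq_zero_of_fn_ae_eq_zero ?_
  exact (volume_absolutelyContinuous d γ).ae_le
    ((coeFn_embedding hγ hp w).symm.trans (Lp.eq_zero_iff_ae_eq_zero.1 hw))

end Embedding

section WeakLimits

theorem exists_tendsto_inner {ι H : Type*} [NormedAddCommGroup H] [InnerProductSpace ℝ H]
    [CompleteSpace H] (U : Ultrafilter ι) {x : ι → H} {K : ℝ} (hx : ∀ i, ‖x i‖ ≤ K) :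
    ∃ y : H, ∀ z, Tendsto (fun i => inner ℝ (x i) z) U (𝓝 (inner ℝ y z)) := by
  let x' : ι → WeakDual ℝ H := fun i =>
    StrongDual.toWeakDual (InnerProductSpace.toDual ℝ H (x i))
  obtain ⟨y', -, hy'⟩ := (WeakDual.isCompact_closedBall (0 : StrongDual ℝ H) K).ultrafilter_le_nhds
    (U.map x') (le_principal_iff.2 (mem_map.2 (univ_mem' fun i => by simpa [x'] using hx i)))
  refine ⟨(InnerProductSpace.toDual ℝ H).symm (WeakDual.toStrongDual y'), fun z => ?_⟩
  rw [InnerProductSpace.toDual_symm_apply]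
  exact ((WeakDual.eval_continuous z).tendsto y').comp hy'

theorem norm_le_of_tendsto_inner {ι H : Type*} [NormedAddCommGroup H] [InnerProductSpace ℝ H]
    {l : Filter ι} [l.NeBot] {x : ι → H} {y : H} {b : ℝ}
    (hy : Tendsto (fun i => inner ℝ (x i) y) l (𝓝 (inner ℝ y y)))
    (hb : Tendsto (fun i => ‖x i‖) l (𝓝 b)) : ‖y‖ ≤ b := by
  have hle : ‖y‖ * ‖y‖ ≤ b * ‖y‖ := by
    rw [← real_inner_self_eq_norm_mul_norm]
    exact le_of_tendsto_of_tendsto' hy (hb.mul_const _) fun i => real_inner_le_norm _ _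
  rcases (norm_nonneg y).eq_or_lt with hy0 | hy0
  · rw [← hy0]
    exact ge_of_tendsto' hb fun i => norm_nonneg _
  · exact le_of_mul_le_mul_right hle hy0

theorem eLpNorm_le_of_tendsto_Lp {X F : Type*} [MeasurableSpace X] {μ : Measure X}
    [NormedAddCommGroup F] {r s : ℝ≥0∞} [Fact (1 ≤ r)] {f : ℕ → Lp F r μ} {f₀ : Lp F r μ}
    (hf : Tendsto f atTop (𝓝 f₀)) {b : ℝ≥0∞}
    (hb : Tendsto (fun n => eLpNorm (f n) s μ) atTop (𝓝 b)) : eLpNorm f₀ s μ ≤ b := by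
  obtain ⟨ns, hns, hlim⟩ := (tendstoInMeasure_of_tendsto_Lp hf).exists_seq_tendsto_ae
  refine (Lp.eLpNorm_lim_le_liminf_eLpNorm (fun n => Lp.aestronglyMeasurable _) _ hlim).trans ?_
  exact (hb.comp hns.tendsto_atTop).liminf_eq.le

variable {d : ℕ} [Fact (3 ≤ d)] {γ q : ℝ} [Fact (1 ≤ ENNReal.ofReal q)]

theorem tendsto_integral_mul_of_tendsto_WLp (hγ : 0 ≤ γ) {ι : Type*} {l : Filter ι}
    {w : ι → WLp d γ q} {w₀ : WLp d γ q} (hw : Tendsto w l (𝓝 w₀)) {ψ : Space d → ℝ}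
    (hψ : Continuous ψ) (hψc : HasCompactSupport ψ) :
    Tendsto (fun i => ∫ x, w i x * ψ x) l (𝓝 (∫ x, w₀ x * ψ x)) := by
  obtain ⟨K, hK⟩ := hψc.exists_bound_of_continuous hψ
  obtain ⟨ρ, hρ⟩ := hψc.isCompact.isBounded.subset_ball (0 : Space d)
  have hsupp : ∀ x ∉ Metric.ball 0 (max ρ 1), ψ x = 0 := fun x hx =>
    image_eq_zero_of_notMem_tsupport fun hmem =>
      hx (Metric.ball_subset_ball (le_max_left _ _) (hρ hmem))
  obtain ⟨L, hL⟩ := exists_continuousLinearMap_integral_mul (q := q) hγ (by positivity)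
    hψ.aestronglyMeasurable hK hsupp
  simpa only [hL, Function.comp_def] using (L.continuous.tendsto w₀).comp hw

theorem inner_toLp_smul_const {d : ℕ} {φ : Space d → ℝ} {v : Space d}
    (hφ : MemLp (fun x => φ x • v) 2) (g : Lp (Space d) 2 (volume : Measure (Space d))) :
    inner ℝ g (hφ.toLp _) = ∫ x, inner ℝ (g x) v * φ x := by
  rw [L2.inner_def]
  refine integral_congr_ae ?_
  filter_upwards [hφ.coeFn_toLp] with x hx
  rw [hx, real_inner_smul_right, mul_comm]

theorem hasWeakGradient_of_tendsto (hγ : 0 ≤ γ) {ι : Type*} {l : Filter ι} [l.NeBot]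
    {w : ι → WLp d γ q} {w₀ : WLp d γ q} {g : ι → Lp (Space d) 2 (volume : Measure (Space d))}
    {g₀ : Lp (Space d) 2 (volume : Measure (Space d))}
    (h : ∀ i, HasWeakGradient (w i) (g i)) (hw : Tendsto w l (𝓝 w₀))
    (hg : ∀ z, Tendsto (fun i => inner ℝ (g i) z) l (𝓝 (inner ℝ g₀ z))) :
    HasWeakGradient w₀ g₀ where
  locInt := locallyIntegrable_of_memLp_weightedMeasure hγ (ENNReal.one_le_ofReal.1 Fact.out)
    (aestronglyMeasurable_coeFn w₀) (Lp.memLp w₀)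
  locInt_grad := (Lp.memLp g₀).locallyIntegrable one_le_two
  integral_eq φ hφ hφc v := by
    have hleft := tendsto_integral_mul_of_tendsto_WLp hγ hw (ψ := fun x => fderiv ℝ φ x v)
      ((hφ.continuous_fderiv (by simp)).clm_apply continuous_const) (hφc.fderiv_apply (𝕜 := ℝ) v)
    have hφv : MemLp (fun x => φ x • v) 2 :=
      (hφ.continuous.smul continuous_const).memLp_of_hasCompactSupport hφc.smul_right
    have hright := hg (hφv.toLp _)
    simp only [inner_toLp_smul_const] at hright
    exact tendsto_nhds_unique hleft
      (hright.neg.congr fun i => ((h i).integral_eq φ hφ hφc v).symm)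

end WeakLimits

section Elements

variable {d : ℕ} [Fact (3 ≤ d)] {p γ : ℝ} [Fact (1 < p)]

theorem HasWeakGradient.exists_fn_ae_eq {w : Space d → ℝ} {g : Space d → Space d}
    (h : HasWeakGradient w g)
    (hw : MemLp w (ENNReal.ofReal (p + 1)) (weightedMeasure d γ)) (hg : MemLp g 2 volume) :
    ∃ u : HSpace d p γ, fn u =ᵐ[volume] w ∧ grad u =ᵐ[volume] g := by
  have hfst : hw.toLp w =ᵐ[volume] w := (volume_absolutelyContinuous d γ).ae_le hw.coeFn_toLp
  exact ⟨⟨WithLp.toLp 1 (hw.toLp w, hg.toLp g), h.congr hfst hg.coeFn_toLp⟩, hfst, hg.coeFn_toLp⟩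

theorem isFiniteMeasureOnCompacts_weightedMeasure {d : ℕ} [NeZero d] {γ : ℝ}
    (hγ : γ < d) :
    IsFiniteMeasureOnCompacts (weightedMeasure d γ) where
  lt_top_of_isCompact K hK := by
    obtain ⟨ρ, hρ⟩ := hK.isBounded.subset_ball (0 : Space d)
    exact (measure_mono hρ).trans_lt (weightedMeasure_ball_lt_top hγ ρ)

theorem exists_fn_ae_eq_of_contDiff (hγ : γ < d) {φ : Space d → ℝ} (hφ : ContDiff ℝ 1 φ)
    (hφc : HasCompactSupport φ) : ∃ u : HSpace d p γ, fn u =ᵐ[volume] φ := by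
  have := isFiniteMeasureOnCompacts_weightedMeasure hγ
  have hgrad : HasCompactSupport (∇ φ) := (hφc.fderiv (𝕜 := ℝ)).comp_left (map_zero _)
  obtain ⟨u, hu, -⟩ := (hasWeakGradient_gradient hφ).exists_fn_ae_eq (p := p) (γ := γ)
    (hφ.continuous.memLp_of_hasCompactSupport hφc)
    ((continuous_gradient hφ).memLp_of_hasCompactSupport hgrad)
  exact ⟨u, hu⟩

theorem exists_ne_zero (hγ : γ < d) : ∃ w : HSpace d p γ, w ≠ 0 := by
  obtain ⟨w, hw⟩ := exists_fn_ae_eq_of_contDiff (p := p) hγ (cutoffBump d).contDiff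
    (cutoffBump d).hasCompactSupport
  refine ⟨w, fun hw0 => ?_⟩
  have hfn : fn w =ᵐ[volume] 0 := by
    rw [hw0]
    exact (volume_absolutelyContinuous d γ).ae_le (Lp.coeFn_zero _ _ _)
  have hbump : ⇑(cutoffBump d) = 0 := (Continuous.ae_eq_iff_eq volume (cutoffBump d).continuous
    continuous_zero).1 (hw.symm.trans hfn)
  have hone : cutoffBump d 0 = 1 := (cutoffBump d).one_of_mem_closedBall (by simp [cutoffBump])
  simp [hbump] at hone

end Elements

section Scaling

theorem lintegral_weightedMeasure {d : ℕ} {γ : ℝ} (f : Space d → ℝ≥0∞) :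
    ∫⁻ x, f x ∂weightedMeasure d γ = ∫⁻ x, ENNReal.ofReal (‖x‖ ^ (-γ)) * f x := by
  simpa only [setLIntegral_univ] using setLIntegral_weightedMeasure MeasurableSet.univ f

theorem lintegral_comp_smul {d : ℕ} {f : Space d → ℝ≥0∞} (hf : Measurable f) {l : ℝ}
    (hl : l ≠ 0) : ∫⁻ x, f (l • x) = ENNReal.ofReal |(l ^ d)⁻¹| * ∫⁻ x, f x := by
  rw [← lintegral_map hf (measurable_const_smul l), Measure.map_addHaar_smul volume hl,
    finrank_euclideanSpace_fin, lintegral_smul_measure, smul_eq_mul]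

theorem norm_rpow_neg_eq_mul_norm_smul {E : Type*} [NormedAddCommGroup E] [NormedSpace ℝ E]
    (x : E) (γ : ℝ) {l : ℝ} (hl : l ≠ 0) : ‖x‖ ^ (-γ) = |l| ^ γ * ‖l • x‖ ^ (-γ) := by
  rw [norm_smul, Real.norm_eq_abs, Real.mul_rpow (abs_nonneg l) (norm_nonneg x), ← mul_assoc,
    ← Real.rpow_add (abs_pos.2 hl), add_neg_cancel, Real.rpow_zero, one_mul]

theorem map_smul_weightedMeasure (d : ℕ) (γ : ℝ) {l : ℝ} (hl : l ≠ 0) :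
    (weightedMeasure d γ).map (l • ·) = ENNReal.ofReal (|l| ^ (γ - d)) • weightedMeasure d γ := by
  have hsmul : Measurable fun x : Space d => l • x := measurable_const_smul l
  refine Measure.ext_of_lintegral _ fun f hf => ?_
  rw [lintegral_smul_measure, smul_eq_mul, lintegral_map hf hsmul,
    lintegral_weightedMeasure, lintegral_weightedMeasure]
  calc ∫⁻ x, ENNReal.ofReal (‖x‖ ^ (-γ)) * f (l • x)
      = ∫⁻ x, ENNReal.ofReal (|l| ^ γ) * (ENNReal.ofReal (‖l • x‖ ^ (-γ)) * f (l • x)) := by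
        refine lintegral_congr fun x => ?_
        rw [norm_rpow_neg_eq_mul_norm_smul x γ hl, ENNReal.ofReal_mul (by positivity), mul_assoc]
    _ = ENNReal.ofReal (|l| ^ γ) *
          (ENNReal.ofReal |(l ^ d)⁻¹| * ∫⁻ x, ENNReal.ofReal (‖x‖ ^ (-γ)) * f x) := by
        rw [lintegral_const_mul' _ _ ENNReal.ofReal_ne_top,
          lintegral_comp_smul (f := fun x => ENNReal.ofReal (‖x‖ ^ (-γ)) * f x) (by fun_prop) hl]
    _ = ENNReal.ofReal (|l| ^ (γ - d)) * ∫⁻ x, ENNReal.ofReal (‖x‖ ^ (-γ)) * f x := by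
        rw [← mul_assoc, ← ENNReal.ofReal_mul (by positivity), Real.rpow_sub (abs_pos.2 hl),
          Real.rpow_natCast, abs_inv, abs_pow, div_eq_mul_inv]

variable {d : ℕ} {F : Type*} [NormedAddCommGroup F] {q γ : ℝ}

theorem wnorm_rpow_eq_integral (hq : 0 < q) (f : Space d → F) :
    wnorm q γ f ^ q = ∫ x, ‖f x‖ ^ q ∂weightedMeasure d γ := by
  rw [wnorm, one_div, Real.rpow_inv_rpow (integral_nonneg fun x => by positivity) hq.ne',
    weightedMeasure, integral_withDensity_eq_integral_toReal_smul (by fun_prop) (by simp)]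
  refine integral_congr_ae (Eventually.of_forall fun x => ?_)
  simp only [smul_eq_mul]
  rw [ENNReal.toReal_ofReal (by positivity), mul_comm]

theorem wnorm_congr_ae {f g : Space d → F} (h : f =ᵐ[volume] g) :
    wnorm q γ f = wnorm q γ g := by
  rw [wnorm, wnorm]
  congr 1
  refine integral_congr_ae ?_
  filter_upwards [h] with x hx
  rw [hx]

theorem wnorm_smul_comp_smul_rpow [NormedSpace ℝ F] (hq : 0 < q) (f : Space d → F) (a : ℝ) {l : ℝ}
    (hl : l ≠ 0) :
    wnorm q γ (fun x => a • f (l • x)) ^ q = |a| ^ q * |l| ^ (γ - d) * wnorm q γ f ^ q := by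
  have hmap : ∫ x, ‖f (l • x)‖ ^ q ∂weightedMeasure d γ
      = |l| ^ (γ - d) * ∫ x, ‖f x‖ ^ q ∂weightedMeasure d γ := by
    rw [← (measurableEmbedding_const_smul₀ hl).integral_map (fun x => ‖f x‖ ^ q),
      map_smul_weightedMeasure d γ hl, integral_smul_measure,
      ENNReal.toReal_ofReal (by positivity), smul_eq_mul]
  simp_rw [wnorm_rpow_eq_integral hq, norm_smul, Real.norm_eq_abs,
    Real.mul_rpow (abs_nonneg a) (norm_nonneg _)]
  rw [integral_const_mul, hmap, mul_assoc]

theorem memLp_comp_smul_weightedMeasure {r : ℝ≥0∞} {f : Space d → F}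
    (hf : MemLp f r (weightedMeasure d γ)) {l : ℝ} (hl : l ≠ 0) :
    MemLp (fun x => f (l • x)) r (weightedMeasure d γ) :=
  MemLp.comp_of_map (f := (l • ·))
    (map_smul_weightedMeasure d γ hl ▸ hf.smul_measure ENNReal.ofReal_ne_top) (by fun_prop)

end Scaling

section Dilations

theorem memLp_comp_smul {d : ℕ} {F : Type*} [NormedAddCommGroup F] {r : ℝ≥0∞} {f : Space d → F}
    (hf : MemLp f r volume) {l : ℝ} (hl : l ≠ 0) : MemLp (fun x => f (l • x)) r volume :=
  MemLp.comp_of_map (f := fun x : Space d => l • x)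
    (by rw [Measure.map_addHaar_smul volume hl]; exact hf.smul_measure ENNReal.ofReal_ne_top)
    (by fun_prop)

theorem locallyIntegrable_comp_smul {d : ℕ} {F : Type*} [NormedAddCommGroup F] {f : Space d → F}
    (hf : LocallyIntegrable f volume) {l : ℝ} (hl : l ≠ 0) :
    LocallyIntegrable (fun x => f (l • x)) (volume : Measure (Space d)) := by
  refine (locallyIntegrable_map_homeomorph (Homeomorph.smulOfNeZero l hl)).1 ?_
  change LocallyIntegrable f (Measure.map (fun x : Space d => l • x) volume)
  rw [Measure.map_addHaar_smul volume hl]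
  intro x
  obtain ⟨s, hs, hfs⟩ := hf x
  refine ⟨s, hs, ?_⟩
  rw [IntegrableOn, Measure.restrict_smul]
  exact Integrable.smul_measure hfs ENNReal.ofReal_ne_top

theorem HasWeakGradient.comp_smul {d : ℕ} {w : Space d → ℝ} {g : Space d → Space d}
    (h : HasWeakGradient w g) {l : ℝ} (hl : l ≠ 0) :
    HasWeakGradient (fun x => w (l • x)) (fun x => l • g (l • x)) where
  locInt := locallyIntegrable_comp_smul h.locInt hl
  locInt_grad := (locallyIntegrable_comp_smul h.locInt_grad hl).smul l
  integral_eq φ hφ hφc v := by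
    set ψ : Space d → ℝ := fun x => φ (l⁻¹ • x) with hψ_def
    have hψ : ContDiff ℝ ∞ ψ := hφ.comp (contDiff_const_smul _)
    have hψc : HasCompactSupport ψ :=
      hφc.comp_homeomorph (Homeomorph.smulOfNeZero l⁻¹ (inv_ne_zero hl))
    have hderiv : ∀ x, fderiv ℝ φ x = l • fderiv ℝ ψ (l • x) := fun x => by
      rw [← fderiv_comp_smul]
      simp [hψ_def, inv_smul_smul₀ hl]
    calc ∫ x, w (l • x) * fderiv ℝ φ x v
        = l * ∫ x, w (l • x) * fderiv ℝ ψ (l • x) v := by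
          rw [← integral_const_mul]
          refine integral_congr_ae (Eventually.of_forall fun x => ?_)
          simp only [hderiv, smul_apply, smul_eq_mul]
          ring
      _ = -(l * ∫ x, inner ℝ (g (l • x)) v * ψ (l • x)) := by
          rw [Measure.integral_comp_smul volume (fun x => w x * fderiv ℝ ψ x v),
            Measure.integral_comp_smul volume (fun x => inner ℝ (g x) v * ψ x),
            h.integral_eq ψ hψ hψc v, smul_neg, mul_neg]
      _ = -∫ x, inner ℝ (l • g (l • x)) v * φ x := by
          rw [← integral_const_mul]
          simp only [hψ_def, inv_smul_smul₀ hl, real_inner_smul_left, mul_assoc]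

variable {d : ℕ} [Fact (3 ≤ d)] {p γ : ℝ} [Fact (1 < p)]

theorem exists_fn_ae_eq_smul_comp_smul (w : HSpace d p γ) (a : ℝ) {l : ℝ} (hl : l ≠ 0) :
    ∃ v : HSpace d p γ, fn v =ᵐ[volume] (fun x => a • fn w (l • x)) ∧
      grad v =ᵐ[volume] fun x => (a * l) • grad w (l • x) := by
  have hweak := ((hasWeakGradient_fn w).comp_smul hl).smul a
  obtain ⟨v, hfn, hgrad⟩ := hweak.exists_fn_ae_eq (p := p) (γ := γ)
    ((memLp_comp_smul_weightedMeasure (Lp.memLp w.1.fst) hl).const_smul a)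
    (((memLp_comp_smul (Lp.memLp w.1.snd) hl).const_smul l).const_smul a)
  refine ⟨v, hfn, hgrad.trans (Eventually.of_forall fun x => ?_)⟩
  simp [mul_smul]

theorem exists_G_eq_mass_eq_of_scaling (w : HSpace d p γ) {a l : ℝ} (ha : 0 < a) (hl : 0 < l) :
    ∃ v : HSpace d p γ, mass v = a ^ (2 * p) * l ^ (γ - d) * mass w ∧
      G v = 1 / 2 * (a ^ (2 : ℝ) * l ^ (2 - d : ℝ) * wnorm 2 0 (grad w) ^ 2) +
        1 / (p + 1) * (a ^ (p + 1) * l ^ (γ - d) * wnorm (p + 1) γ (fn w) ^ (p + 1)) := by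
  have hp1 : 1 < p := Fact.out
  obtain ⟨v, hfn, hgrad⟩ := exists_fn_ae_eq_smul_comp_smul w a hl.ne'
  have hfn_norm : ∀ q : ℝ, 0 < q →
      wnorm q γ (fn v) ^ q = a ^ q * l ^ (γ - d) * wnorm q γ (fn w) ^ q := fun q hq => by
    rw [wnorm_congr_ae hfn, wnorm_smul_comp_smul_rpow hq _ a hl.ne', abs_of_pos ha,
      abs_of_pos hl]
  have hgrad_norm :
      wnorm 2 0 (grad v) ^ 2 = a ^ (2 : ℝ) * l ^ (2 - d : ℝ) * wnorm 2 0 (grad w) ^ 2 := by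
    rw [wnorm_congr_ae hgrad, ← Real.rpow_two, ← Real.rpow_two,
      wnorm_smul_comp_smul_rpow two_pos _ (a * l) hl.ne', abs_of_pos (mul_pos ha hl),
      abs_of_pos hl, Real.mul_rpow ha.le hl.le, mul_assoc (a ^ (2 : ℝ)), ← Real.rpow_add hl]
    ring_nf
  refine ⟨v, hfn_norm (2 * p) (by linarith), ?_⟩
  rw [G, hgrad_norm, hfn_norm (p + 1) (by linarith)]

theorem lt_two_of_mul_sub_two_lt (hp : p * (d - 2) < d - γ) : γ < 2 := by
  have hp1 : 1 < p := Fact.out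
  nlinarith [three_le_natCast d]

theorem theta_denominator_pos (hp : p * (d - 2) < d - γ) : 0 < d - γ - p * (d + γ - 4) := by
  have hp1 : 1 < p := Fact.out
  nlinarith [lt_two_of_mul_sub_two_lt hp]

theorem theta_pos (hp : p * (d - 2) < d - γ) : 0 < theta d p γ :=
  div_pos (by linarith [lt_two_of_mul_sub_two_lt hp]) (theta_denominator_pos hp)

theorem exists_mass_eq_mul_G_eq_rpow_mul (hp : p * (d - 2) < d - γ) (w : HSpace d p γ) {m : ℝ}
    (hm : 0 < m) :
    ∃ v : HSpace d p γ, mass v = m * mass w ∧ G v = m ^ theta d p γ * G w := by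
  have hN : d - γ - p * (d + γ - 4) ≠ 0 := (theta_denominator_pos hp).ne'
  set N : ℝ := d - γ - p * (d + γ - 4) with hN_def
  -- The amplitude `a` and the dilation `l` solve `a ^ (2p) l ^ (γ - d) = m` together with
  -- `a ^ 2 l ^ (2 - d) = a ^ (p + 1) l ^ (γ - d)`, which is then `m ^ θ`.
  obtain ⟨v, hmass, hG⟩ := exists_G_eq_mass_eq_of_scaling w (a := m ^ ((2 - γ) / N))
    (l := m ^ ((p - 1) / N)) (by positivity) (by positivity)
  have hpow : ∀ r s : ℝ, (m ^ ((2 - γ) / N)) ^ r * (m ^ ((p - 1) / N)) ^ s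
      = m ^ (((2 - γ) * r + (p - 1) * s) / N) := fun r s => by
    rw [← Real.rpow_mul hm.le, ← Real.rpow_mul hm.le, ← Real.rpow_add hm]
    ring_nf
  have hexp_mass : ((2 - γ) * (2 * p) + (p - 1) * (γ - d)) / N = 1 := by
    rw [div_eq_one_iff_eq hN, hN_def]
    ring
  have hexp_grad : ((2 - γ) * 2 + (p - 1) * (2 - d)) / N = theta d p γ := by
    rw [theta, ← hN_def]
    ring
  have hexp_fn : ((2 - γ) * (p + 1) + (p - 1) * (γ - d)) / N = theta d p γ := by
    rw [theta, ← hN_def]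
    ring
  rw [hpow, hexp_mass, Real.rpow_one] at hmass
  rw [hpow, hpow, hexp_grad, hexp_fn] at hG
  refine ⟨v, hmass, ?_⟩
  rw [hG, G]
  ring

end Dilations

section Minimization

variable {d : ℕ} [Fact (3 ≤ d)] {p γ : ℝ} [Fact (1 < p)]

theorem G_eq (w : HSpace d p γ) :
    G w = 1 / 2 * ‖w.1.snd‖ ^ 2 + 1 / (p + 1) * ‖w.1.fst‖ ^ (p + 1) := by
  have hp1 : 1 < p := Fact.out
  have hfst : ‖w.1.fst‖ = wnorm (p + 1) γ (fn w) := norm_WLp_eq (by linarith) _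
  have hnorm := norm_HSpace_eq w
  rw [norm_HSpace_eq_add w, hfst] at hnorm
  rw [G, hfst, add_left_cancel hnorm]

theorem G_nonneg (w : HSpace d p γ) : 0 ≤ G w := by
  have hp1 : 1 < p := Fact.out
  rw [G_eq]
  positivity

theorem le_max_one_of_rpow_le {t A q : ℝ} (hq : 1 ≤ q) (h : t ^ q ≤ A) : t ≤ max 1 A := by
  rcases le_or_gt t 1 with ht | ht
  · exact ht.trans (le_max_left _ _)
  · exact ((Real.self_le_rpow_of_one_le ht.le hq).trans h).trans (le_max_right _ _)

theorem norm_le_of_G_le {w : HSpace d p γ} {C : ℝ} (hw : G w ≤ C) :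
    ‖w‖ ≤ max 1 ((p + 1) * C) + max 1 (2 * C) := by
  have hp1 : 1 < p := Fact.out
  have hsnd_nonneg : 0 ≤ 1 / 2 * ‖w.1.snd‖ ^ 2 := by positivity
  have hfst_nonneg : 0 ≤ 1 / (p + 1) * ‖w.1.fst‖ ^ (p + 1) := by positivity
  rw [G_eq] at hw
  have hfst : 1 / (p + 1) * ‖w.1.fst‖ ^ (p + 1) ≤ C := by linarith
  rw [one_div, inv_mul_le_iff₀ (by linarith)] at hfst
  have hsnd : ‖w.1.snd‖ ^ (2 : ℝ) ≤ 2 * C := by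
    rw [Real.rpow_two]
    linarith
  rw [norm_HSpace_eq_add w]
  exact add_le_add (le_max_one_of_rpow_le (by linarith) hfst)
    (le_max_one_of_rpow_le one_le_two hsnd)

theorem mass_eq (hγ : 0 < γ) (hp : p * (d - 2) < d - γ) (w : HSpace d p γ) :
    mass w = ‖embedding hγ hp w‖ ^ (2 * p) := by
  have hp1 : 1 < p := Fact.out
  rw [norm_WLp_eq (by linarith), mass,
    wnorm_congr_ae ((volume_absolutelyContinuous d γ).ae_le (coeFn_embedding hγ hp w))]

theorem mass_zero (hγ : 0 < γ) (hp : p * (d - 2) < d - γ) : mass (0 : HSpace d p γ) = 0 := by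
  have hp1 : 1 < p := Fact.out
  rw [mass_eq hγ hp, map_zero, norm_zero, Real.zero_rpow (by linarith)]

theorem mass_pos (hγ : 0 < γ) (hp : p * (d - 2) < d - γ) {w : HSpace d p γ} (hw : w ≠ 0) :
    0 < mass w := by
  rw [mass_eq hγ hp]
  refine Real.rpow_pos_of_pos (norm_pos_iff.2 fun h => hw ?_) _
  exact embedding_injective hγ hp (h.trans (map_zero _).symm)

theorem mass_eq_of_tendsto_embedding (hγ : 0 < γ) (hp : p * (d - 2) < d - γ)
    {ι : Type*} {l : Filter ι} [l.NeBot] {w : ι → HSpace d p γ} {v : HSpace d p γ} {M : ℝ}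
    (hw : Tendsto (fun i => embedding hγ hp (w i)) l (𝓝 (embedding hγ hp v)))
    (hM : ∀ i, mass (w i) = M) : mass v = M := by
  have hp1 : 1 < p := Fact.out
  have hlim : Tendsto (fun i => mass (w i)) l (𝓝 (mass v)) := by
    simp only [mass_eq hγ hp]
    exact hw.norm.rpow_const (Or.inr (by linarith))
  simp only [hM] at hlim
  exact tendsto_nhds_unique hlim tendsto_const_nhds

theorem exists_mass_eq (hγ : 0 < γ) (hp : p * (d - 2) < d - γ) {M : ℝ} (hM : 0 < M) :
    ∃ w : HSpace d p γ, mass w = M := by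
  obtain ⟨w, hw⟩ := exists_ne_zero (d := d) (p := p) (γ := γ)
    (by linarith [lt_two_of_mul_sub_two_lt hp, three_le_natCast d])
  have hw0 := mass_pos hγ hp hw
  obtain ⟨v, hv, -⟩ := exists_mass_eq_mul_G_eq_rpow_mul hp w (div_pos hM hw0)
  exact ⟨v, by rw [hv, div_mul_cancel₀ _ hw0.ne']⟩

theorem exists_embedding_eq_of_tendsto (hγ : 0 < γ) (hp : p * (d - 2) < d - γ)
    {w : ℕ → HSpace d p γ} {f : WLp d γ (2 * p)}
    (hf : Tendsto (fun n => embedding hγ hp (w n)) atTop (𝓝 f)) {a b K : ℝ}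
    (ha : Tendsto (fun n => ‖(w n).1.fst‖) atTop (𝓝 a))
    (hb : Tendsto (fun n => ‖(w n).1.snd‖) atTop (𝓝 b)) (hK : ∀ n, ‖(w n).1.snd‖ ≤ K) :
    ∃ v : HSpace d p γ, embedding hγ hp v = f ∧ ‖v.1.fst‖ ≤ a ∧ ‖v.1.snd‖ ≤ b := by
  have hfst : eLpNorm f (ENNReal.ofReal (p + 1)) (weightedMeasure d γ) ≤ ENNReal.ofReal a := by
    refine eLpNorm_le_of_tendsto_Lp hf ((ENNReal.tendsto_ofReal ha).congr fun n => ?_)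
    rw [ofReal_norm, Lp.enorm_def, eLpNorm_congr_ae (coeFn_embedding hγ hp (w n)), fn]
  have hU : (hyperfilter ℕ : Filter ℕ) ≤ atTop := Nat.hyperfilter_le_atTop
  obtain ⟨g, hg⟩ := exists_tendsto_inner (hyperfilter ℕ) hK
  have hweak : HasWeakGradient f g := hasWeakGradient_of_tendsto hγ.le
    (fun n => (hasWeakGradient_fn (w n)).congr
      ((volume_absolutelyContinuous d γ).ae_le (coeFn_embedding hγ hp (w n))) .rfl)
    (hf.mono_left hU) hg
  obtain ⟨v, hvf, hvg⟩ := hweak.exists_fn_ae_eq (p := p) (γ := γ)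
    ⟨Lp.aestronglyMeasurable f, hfst.trans_lt ENNReal.ofReal_lt_top⟩ (Lp.memLp g)
  replace hvf := (weightedMeasure_absolutelyContinuous d γ).ae_le hvf
  refine ⟨v, Lp.ext ((coeFn_embedding hγ hp v).trans hvf), ?_, ?_⟩
  · have ha0 : 0 ≤ a := ge_of_tendsto' ha fun n => norm_nonneg _
    rw [Lp.norm_def]
    exact ENNReal.toReal_le_of_le_ofReal ha0 ((eLpNorm_congr_ae hvf).trans_le hfst)
  · rw [show v.1.snd = g from Lp.ext hvg]
    exact norm_le_of_tendsto_inner (hg g) (hb.mono_left hU)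

theorem exists_subseq_tendsto_embedding_norm (hγ : 0 < γ) (hp : p * (d - 2) < d - γ)
    {w : ℕ → HSpace d p γ} {K : ℝ} (hK : ∀ n, ‖w n‖ ≤ K) :
    ∃ (f : WLp d γ (2 * p)) (a b : ℝ) (φ : ℕ → ℕ), StrictMono φ ∧
      Tendsto (fun n => embedding hγ hp (w (φ n))) atTop (𝓝 f) ∧
      Tendsto (fun n => ‖(w (φ n)).1.fst‖) atTop (𝓝 a) ∧
      Tendsto (fun n => ‖(w (φ n)).1.snd‖) atTop (𝓝 b) := by
  obtain ⟨S, hS, hsub⟩ := (isCompactOperator_embedding (p := p) hγ hp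
    ).image_closedBall_subset_compact (f := (embedding hγ hp).toLinearMap) K
  have hmem : ∀ n, (embedding hγ hp (w n), ‖(w n).1.fst‖, ‖(w n).1.snd‖)
      ∈ S ×ˢ (Icc 0 K ×ˢ Icc 0 K) := fun n => by
    have hn := hK n
    refine ⟨hsub ⟨w n, mem_closedBall_zero_iff.2 hn, rfl⟩, ⟨norm_nonneg _, ?_⟩,
      ⟨norm_nonneg _, ?_⟩⟩ <;> rw [norm_HSpace_eq_add (w n)] at hn
    · linarith [norm_nonneg (w n).1.snd]
    · linarith [norm_nonneg (w n).1.fst]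
  obtain ⟨⟨f, a, b⟩, -, φ, hφ, hlim⟩ :=
    (hS.prod (isCompact_Icc.prod isCompact_Icc)).tendsto_subseq hmem
  rw [Prod.tendsto_iff, Prod.tendsto_iff] at hlim
  exact ⟨f, a, b, φ, hφ, hlim⟩

theorem exists_subseq_tendsto_embedding_G_le (hγ : 0 < γ) (hp : p * (d - 2) < d - γ)
    {w : ℕ → HSpace d p γ} {I : ℝ} (hw : Tendsto (fun n => G (w n)) atTop (𝓝 I)) :
    ∃ (v : HSpace d p γ) (φ : ℕ → ℕ),
      Tendsto (fun n => embedding hγ hp (w (φ n))) atTop (𝓝 (embedding hγ hp v)) ∧ G v ≤ I := by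
  have hp1 : 1 < p := Fact.out
  obtain ⟨C, hC⟩ := hw.bddAbove_range
  obtain ⟨f, a, b, φ, hφ, hf, ha, hb⟩ := exists_subseq_tendsto_embedding_norm hγ hp
    fun n => norm_le_of_G_le (hC (mem_range_self n))
  obtain ⟨K, hK⟩ := hb.bddAbove_range
  obtain ⟨v, rfl, hva, hvb⟩ :=
    exists_embedding_eq_of_tendsto hγ hp hf ha hb fun n => hK (mem_range_self n)
  have hG : Tendsto (fun n => G (w (φ n))) atTop
      (𝓝 (1 / 2 * b ^ 2 + 1 / (p + 1) * a ^ (p + 1))) := by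
    simp only [G_eq]
    exact ((hb.pow 2).const_mul _).add ((ha.rpow_const (Or.inr (by linarith))).const_mul _)
  refine ⟨v, φ, hf, ?_⟩
  rw [tendsto_nhds_unique (hw.comp hφ.tendsto_atTop) hG, G_eq]
  gcongr

theorem exists_minimizer (hγ : 0 < γ) (hp : p * (d - 2) < d - γ) {M : ℝ} (hM : 0 < M) :
    ∃ w : HSpace d p γ, mass w = M ∧ IsMinOn G {v : HSpace d p γ | mass v = M} w := by
  have hbdd : BddBelow (G '' {v : HSpace d p γ | mass v = M}) :=
    ⟨0, by rintro _ ⟨v, -, rfl⟩; exact G_nonneg v⟩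
  have hne : (G '' {v : HSpace d p γ | mass v = M}).Nonempty :=
    Set.Nonempty.image G (exists_mass_eq hγ hp hM)
  obtain ⟨y, -, hy, hyG⟩ := exists_seq_tendsto_sInf hne hbdd
  choose w hwM hwG using hyG
  obtain rfl : (fun n => G (w n)) = y := funext hwG
  obtain ⟨v, φ, hv, hGv⟩ := exists_subseq_tendsto_embedding_G_le hγ hp hy
  exact ⟨v, mass_eq_of_tendsto_embedding hγ hp hv fun n => hwM (φ n),
    isMinOn_iff.2 fun u hu => hGv.trans (csInf_le hbdd ⟨u, hu, rfl⟩)⟩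

theorem G_mul_mass_rpow_theta_le (hγ : 0 < γ) (hp : p * (d - 2) < d - γ) {w : HSpace d p γ}
    (hmass : 0 < mass w) (hw : IsMinOn G {v : HSpace d p γ | mass v = mass w} w)
    (v : HSpace d p γ) :
    G w * mass v ^ theta d p γ ≤ G v * mass w ^ theta d p γ := by
  rcases eq_or_ne v 0 with rfl | hv
  · rw [mass_zero hγ hp, Real.zero_rpow (theta_pos hp).ne', mul_zero]
    have := G_nonneg (0 : HSpace d p γ)
    positivity
  · have hv0 := mass_pos hγ hp hv
    obtain ⟨u, hu, hGu⟩ := exists_mass_eq_mul_G_eq_rpow_mul hp v (div_pos hmass hv0)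
    rw [div_mul_cancel₀ _ hv0.ne'] at hu
    calc G w * mass v ^ theta d p γ
        ≤ ((mass w / mass v) ^ theta d p γ * G v) * mass v ^ theta d p γ := by
          rw [← hGu]
          gcongr
          exact isMinOn_iff.1 hw u hu
      _ = G v * mass w ^ theta d p γ := by
          rw [Real.div_rpow hmass.le hv0.le]
          field_simp

theorem wnorm_fn_rpow_eq_mass_rpow (w : HSpace d p γ) (r : ℝ) :
    wnorm (2 * p) γ (fn w) ^ (2 * p * r) = mass w ^ r :=
  Real.rpow_mul (Real.rpow_nonneg (integral_nonneg fun x => by positivity) _) _ _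

theorem G_eq_J_mul_rpow_theta (hγ : 0 < γ) (hp : p * (d - 2) < d - γ) {w : HSpace d p γ}
    (hmass : 0 < mass w) (hw : IsMinOn G {v : HSpace d p γ | mass v = mass w} w) :
    G w = J d p γ * mass w ^ theta d p γ := by
  have hpow : 0 < mass w ^ theta d p γ := Real.rpow_pos_of_pos hmass _
  have hgreatest : IsGreatest {C : ℝ | ∀ v : HSpace d p γ,
      0 ≤ G v - C * mass v ^ theta d p γ} (G w / mass w ^ theta d p γ) := by
    refine ⟨fun v => ?_, fun C hC => ?_⟩
    · rw [sub_nonneg, div_mul_eq_mul_div, div_le_iff₀ hpow]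
      exact G_mul_mass_rpow_theta_le hγ hp hmass hw v
    · exact (le_div_iff₀ hpow).2 (sub_nonneg.1 (hC w))
  simp only [J, wnorm_fn_rpow_eq_mass_rpow]
  rw [hgreatest.csSup_eq, div_mul_cancel₀ _ hpow.ne']

end Minimization

end CKN

theorem mainTheorem6 (d : ℕ) [Fact (3 ≤ d)] (p γ : ℝ) [Fact (1 < p)]
    (hγ0 : 0 < γ) (hγ2 : γ < 2) (hp : p < CKN.critExp d γ / 2) :
    (∃ ι : CKN.HSpace d p γ →L[ℝ] CKN.WLp d γ (2 * p),
      (∀ w : CKN.HSpace d p γ, (ι w : CKN.Space d → ℝ) =ᵐ[volume] CKN.fn w) ∧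
      Function.Injective ι ∧ IsCompactOperator ι) ∧
    (∀ M : ℝ, 0 < M →
      CKN.J d p γ = 1 / M ^ CKN.theta d p γ *
        sInf (CKN.G '' {w : CKN.HSpace d p γ | CKN.mass w = M}) ∧
      ∃ w : CKN.HSpace d p γ, CKN.mass w = M ∧
        IsMinOn CKN.G {v : CKN.HSpace d p γ | CKN.mass v = M} w ∧
        CKN.G w = CKN.J d p γ * M ^ CKN.theta d p γ) := by
  have hd : (3 : ℝ) ≤ d := CKN.three_le_natCast d
  have hp' : p * (d - 2) < d - γ := by
    rwa [CKN.critExp, mul_div_cancel_left₀ _ two_ne_zero, lt_div_iff₀ (by linarith)] at hp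
  refine ⟨⟨CKN.embedding hγ0 hp', fun w => (CKN.volume_absolutelyContinuous d γ).ae_le
    (CKN.coeFn_embedding hγ0 hp' w), CKN.embedding_injective hγ0 hp',
    CKN.isCompactOperator_embedding hγ0 hp'⟩, fun M hM => ?_⟩
  obtain ⟨w, rfl, hw⟩ := CKN.exists_minimizer (d := d) (p := p) hγ0 hp' hM
  have hJ := CKN.G_eq_J_mul_rpow_theta hγ0 hp' hM hw
  have hleast : IsLeast (CKN.G '' {v : CKN.HSpace d p γ | CKN.mass v = CKN.mass w}) (CKN.G w) :=
    ⟨⟨w, rfl, rfl⟩, by rintro _ ⟨v, hv, rfl⟩; exact isMinOn_iff.1 hw v hv⟩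
  refine ⟨?_, w, rfl, hw, hJ⟩
  have hpow : CKN.mass w ^ CKN.theta d p γ ≠ 0 := (Real.rpow_pos_of_pos hM _).ne'
  rw [hleast.csInf_eq, hJ]
  field_simp
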